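/- A clause (a disjunction of literals) is horn if it has at most one positive literal, and co-horn if it has at most one negative literal. A Boolean relation $R\subseteq\{0,1\}^n$ is horn (resp. co-horn) if it is the set of satisfying assignments of a conjunction of horn (resp. co-horn) clauses in the variables $x_0,\dots,x_{n-1}$. For a class $S$ of Boolean relations, an $S$-formula over a set $V$ of variables is an expression $R(y_0,\dots,y_{n-1})$ with $R\in S$ of arity $n$ and $y_0,\dots,y_{n-1}\in V$ (not necessarily distinct). A set $C$ of formulas is finitely satisfiable if each finite subset of $C$ is satisfied by some truth assignment. A set $H\subseteq V$ is homogeneous for $C$ with color $c\in\{0,1\}$ if each finite subset of $C$ is satisfied by some truth assignment $\nu$ with $\nu(a)=c$ for all $a\in H$; it is homogeneous for $C$ if it is so with some color. $\mathsf{LRSAT}(S)$ is the statement: for every infinite set $V$ of variables, every finitely satisfiable set $C$ of $S$-formulas over $V$ and every infinite set $L\subseteq V$, there is an infinite set $H\subseteq L$ that is homogeneous for $C$. Let $\mathsf{RCA}_0$ be the system of second-order arithmetic with the basic axioms of arithmetic, $\Sigma^0_1$ induction and $\Delta^0_1$ comprehension, where finite sets, Boolean relations and formulas are coded by numbers in the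 usual way. Here $S$ is an arbitrary, possibly infinite, class of (codes of) Boolean relations, given by any formula of the language of second-order arithmetic (with parameters, and possibly with an additional unary predicate symbol about which there are no axioms and which does not occur in the induction and comprehension schemes). **Theorem.** $\mathsf{RCA}_0$ proves: if every relation in $S$ is horn, then $\mathsf{LRSAT}(S)$; and $\mathsf{RCA}_0$ proves: if every relation in $S$ is co-horn, then $\mathsf{LRSAT}(S)$. More precisely, put $c=1$ in the horn case and $c=0$ in the co-horn case, and for an instance $(V,C,L)$ let $F$ be the class of the $x\in L$ for which there is a finite $C_0\subseteq C$ such that $\nu(x)=c$ for all truth assignments $\nu$ that satisfy $C_0$. Then there is a $\Sigma^0_1$ formula $\theta(x)$ with parameters $V,C,L$, independent of $S$, such that $\mathsf{RCA}_0$ proves, if every relation in $S$ is horn (resp. co-horn): for each instance $(V,C,L)$ of $\mathsf{LRSAT}(S)$, the class $F$ is defined by $\theta$, and there is an infinite set $H\subseteq L$ such that either $F$ is infinite, $H\subseteq F$ and $H$ is homogeneous for $C$ with color $c$, or $F$ is finite, $H=L\setminus F$ and $H$ is homogeneous for $C$ with color $1-c$. -/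

import Mathlib

namespace SOA

/-! ## The language of second-order arithmetic

Two sorts of variables, for numbers and for sets of numbers, both in de Bruijn style: `var i` is
bound by the `i`-th enclosing number quantifier, or free if there is none; set variables are
counted separately, by the enclosing set quantifiers. -/

/-- Number terms. -/
inductive Tm : Type
  | var : ℕ → Tm
  | zero : Tm
  | one : Tm
  | add : Tm → Tm → Tm
  | mul : Tm → Tm → Tm

prefix:max "♯" => Tm.var

instance : Zero Tm := ⟨Tm.zero⟩
instance : One Tm := ⟨Tm.one⟩
instance : Add Tm := ⟨Tm.add⟩
instance : Mul Tm := ⟨Tm.mul⟩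

/-- Formulas.  Besides the symbols of second-order arithmetic there is a unary predicate symbol
`cls` on numbers, for an arbitrary class; it does not occur in the axioms of `RCA0`, nor in the
induction and comprehension formulas.  There is no equality between sets. -/
inductive Fm : Type
  | eq : Tm → Tm → Fm
  | lt : Tm → Tm → Fm
  /-- `mem t X`: the number `t` is an element of the set variable number `X` -/
  | mem : Tm → ℕ → Fm
  | cls : Tm → Fm
  | bot : Fm
  | imp : Fm → Fm → Fm
  /-- quantifier over numbers -/
  | all : Fm → Fm
  /-- quantifier over sets -/
  | allS : Fm → Fm

infixr:60 " ➔ " => Fm.imp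

/-- Simultaneous substitution in a term. -/
def Tm.subst (e : ℕ → Tm) : Tm → Tm
  | .var i => e i
  | .zero => .zero
  | .one => .one
  | .add t u => .add (t.subst e) (u.subst e)
  | .mul t u => .mul (t.subst e) (u.subst e)

/-- `t.up k` is `t` seen from under `k` more number quantifiers. -/
def Tm.up (t : Tm) (k : ℕ) : Tm := t.subst fun i => ♯(i + k)

/-- `t` for the variable `0`, and `e i` for the variable `i + 1`. -/
def scons {α : Type} (t : α) (e : ℕ → α) : ℕ → α
  | 0 => t
  | i + 1 => e i

/-- Capture-avoiding simultaneous substitution of the terms `e i` for the number variables and of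
the set variables `f i` for the set variables. -/
def Fm.subst : (ℕ → Tm) → (ℕ → ℕ) → Fm → Fm
  | e, _, .eq t u => .eq (t.subst e) (u.subst e)
  | e, _, .lt t u => .lt (t.subst e) (u.subst e)
  | e, f, .mem t X => .mem (t.subst e) (f X)
  | e, _, .cls t => .cls (t.subst e)
  | _, _, .bot => .bot
  | e, f, .imp φ ψ => .imp (φ.subst e f) (ψ.subst e f)
  | e, f, .all φ => .all (φ.subst (scons ♯0 fun i => (e i).up 1) f)
  | e, f, .allS φ => .allS (φ.subst e (scons 0 fun i => f i + 1))

/-- Weakening of `φ` under one more number quantifier. -/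
def Fm.wk (φ : Fm) : Fm := φ.subst (fun i => ♯(i + 1)) id

/-- Weakening of `φ` under one more set quantifier. -/
def Fm.wkS (φ : Fm) : Fm := φ.subst Tm.var (· + 1)

/-- `φ` with `t` for the number variable `0` (and the other number variables moved down). -/
def Fm.inst (φ : Fm) (t : Tm) : Fm := φ.subst (scons t Tm.var) id

/-- `φ` with `X` for the set variable `0` (and the other set variables moved down). -/
def Fm.instS (φ : Fm) (X : ℕ) : Fm := φ.subst Tm.var (scons X id)

/-- `φ` as a predicate of its number variable `0`, at `t`, where `t` lives under `k` additional
number quantifiers and `s` additional set quantifiers. -/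
def Fm.at (φ : Fm) (k s : ℕ) (t : Tm) : Fm := φ.subst (scons t fun i => ♯(i + k)) (· + s)

def Fm.neg (φ : Fm) : Fm := φ ➔ .bot
def Fm.and (φ ψ : Fm) : Fm := (φ ➔ ψ.neg).neg
def Fm.or (φ ψ : Fm) : Fm := φ.neg ➔ ψ
def Fm.iff (φ ψ : Fm) : Fm := (φ ➔ ψ).and (ψ ➔ φ)
def Fm.ex (φ : Fm) : Fm := φ.neg.all.neg
def Fm.exS (φ : Fm) : Fm := φ.neg.allS.neg

infixr:63 " ⋏ " => Fm.and
infixr:62 " ⋎ " => Fm.or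
infix:58 " ⟺ " => Fm.iff
infix:64 " ≐ " => Fm.eq
infix:64 " ≺ " => Fm.lt
infix:64 " ε " => Fm.mem

/-! ## Provability -/

/-- Classical natural deduction with equality.  `Derives T Γ φ`: the formula `φ` is derivable from
the axioms `T` and the assumptions `Γ`.  Free variables of an axiom are read as universally
quantified, so that each substitution instance of an axiom may be used; the free variables of an
assumption are fixed. -/
inductive Derives (T : Set Fm) : List Fm → Fm → Prop
  | ax {Γ : List Fm} {φ : Fm} (h : φ ∈ T) (e : ℕ → Tm) (f : ℕ → ℕ) : Derives T Γ (φ.subst e f)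
  | hyp {Γ : List Fm} {φ : Fm} (h : φ ∈ Γ) : Derives T Γ φ
  | impI {Γ : List Fm} {φ ψ : Fm} (h : Derives T (φ :: Γ) ψ) : Derives T Γ (φ ➔ ψ)
  | impE {Γ : List Fm} {φ ψ : Fm} (h : Derives T Γ (φ ➔ ψ)) (h' : Derives T Γ φ) : Derives T Γ ψ
  | contra {Γ : List Fm} {φ : Fm} (h : Derives T (φ.neg :: Γ) .bot) : Derives T Γ φ
  | allI {Γ : List Fm} {φ : Fm} (h : Derives T (Γ.map Fm.wk) φ) : Derives T Γ φ.all
  | allE {Γ : List Fm} {φ : Fm} (h : Derives T Γ φ.all) (t : Tm) : Derives T Γ (φ.inst t)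
  | allSI {Γ : List Fm} {φ : Fm} (h : Derives T (Γ.map Fm.wkS) φ) : Derives T Γ φ.allS
  | allSE {Γ : List Fm} {φ : Fm} (h : Derives T Γ φ.allS) (X : ℕ) : Derives T Γ (φ.instS X)
  | eqI {Γ : List Fm} (t : Tm) : Derives T Γ (t ≐ t)
  | eqE {Γ : List Fm} {t u : Tm} (φ : Fm) (h : Derives T Γ (t ≐ u)) (h' : Derives T Γ (φ.inst t)) :
      Derives T Γ (φ.inst u)

/-- `T ⊢ φ`. -/
def Proves (T : Set Fm) (φ : Fm) : Prop := Derives T [] φ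

/-! ## The axiom system `RCA0` -/

/-- Bounded-quantifier formulas (set variables are allowed as parameters). -/
inductive IsBounded : Fm → Prop
  | eq (t u : Tm) : IsBounded (t ≐ u)
  | lt (t u : Tm) : IsBounded (t ≺ u)
  | mem (t : Tm) (X : ℕ) : IsBounded (t ε X)
  | bot : IsBounded .bot
  | imp {φ ψ : Fm} (h : IsBounded φ) (h' : IsBounded ψ) : IsBounded (φ ➔ ψ)
  | ball (t : Tm) {φ : Fm} (h : IsBounded φ) : IsBounded (♯0 ≺ t.up 1 ➔ φ).all

def IsSigma01 (φ : Fm) : Prop := ∃ θ, IsBounded θ ∧ φ = θ.ex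

def IsPi01 (φ : Fm) : Prop := ∃ θ, IsBounded θ ∧ φ = θ.all

/-- Basic axioms, `Σ⁰₁` induction and `Δ⁰₁` comprehension. -/
inductive RCA0 : Set Fm
  | succ_ne_zero : RCA0 (♯0 + 1 ≐ 0).neg
  | succ_inj : RCA0 (♯0 + 1 ≐ ♯1 + 1 ➔ ♯0 ≐ ♯1)
  | add_zero : RCA0 (♯0 + 0 ≐ ♯0)
  | add_succ : RCA0 (♯0 + (♯1 + 1) ≐ (♯0 + ♯1) + 1)
  | mul_zero : RCA0 (♯0 * 0 ≐ 0)
  | mul_succ : RCA0 (♯0 * (♯1 + 1) ≐ ♯0 * ♯1 + ♯0)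
  | not_lt_zero : RCA0 (♯0 ≺ 0).neg
  | lt_succ : RCA0 (♯0 ≺ ♯1 + 1 ⟺ (♯0 ≺ ♯1 ⋎ ♯0 ≐ ♯1))
  | induction (φ : Fm) (h : IsSigma01 φ) :
      RCA0 (φ.inst 0 ➔ (φ ➔ φ.subst (scons (♯0 + 1) fun i => ♯(i + 1)) id).all ➔ φ.all)
  | comprehension (φ ψ : Fm) (h : IsSigma01 φ) (h' : IsPi01 ψ) :
      RCA0 ((φ ⟺ ψ).all ➔ (♯0 ε 0 ⟺ φ.wkS).all.exS)

/-! ## Coding of finite objects by numbers -/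

/-- The code `(t + u)² + t` of the ordered pair `(t, u)`. -/
def pair (t u : Tm) : Tm := (t + u) * (t + u) + t

/-- `t` is an element of the finite set coded by `c`: `c` is of the form `(k, (m, n))`, and `t < k`,
and `m (t + 1) + 1` divides `n`.  Each number codes a finite set, and in `RCA0` each bounded set
has a code. -/
def elt (t c : Tm) : Fm :=
  -- `∃ k m n, c = (k, (m, n)) ∧ t < k ∧ ∃ q, (m (t + 1) + 1) q = n`
  (c.up 3 ≐ pair ♯2 (pair ♯1 ♯0) ⋏ t.up 3 ≺ ♯2 ⋏
    ((♯2 * (t.up 4 + 1) + 1) * ♯0 ≐ ♯1).ex).ex.ex.ex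

/-! A Boolean vector in `{0,1}ⁿ` is coded by (a code of) the finite set of the `i < n` at which its
value is true.  A Boolean relation `R ⊆ {0,1}ⁿ` is coded by `(n, r)`, where `r` codes the finite set
of (codes of) the vectors in `R`. -/

/-- The vector `v` is in the relation `(n, r)`. -/
def vecMem (n r v : Tm) : Fm :=
  -- `∃ u, u ∈ r ∧ ∀ i, i < n → (i ∈ u ↔ i ∈ v)`
  (elt ♯0 (r.up 1) ⋏ (♯0 ≺ n.up 2 ➔ (elt ♯0 ♯1 ⟺ elt ♯0 (v.up 2))).all).ex

/-! A clause in the variables `x_i` (`i < n`) is coded by `(p, q)`, where `p` and `q` code the finite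
sets of the indices of its positive and of its negative literals; a conjunction of clauses is coded
by (a code of) the finite set of its clauses. -/

/-- The finite set `p` has at most one element. -/
def atMostOne (p : Tm) : Fm :=
  -- `∀ i j, i ∈ p → j ∈ p → i = j`
  (elt ♯1 (p.up 2) ➔ elt ♯0 (p.up 2) ➔ ♯1 ≐ ♯0).all.all

/-- All elements of the finite set `p` are less than `n`. -/
def below (p n : Tm) : Fm := (elt ♯0 (p.up 1) ➔ ♯0 ≺ n.up 1).all

/-- `h` is a conjunction of clauses in the variables `x_i`, `i < n`, each with at most one positive
literal (`c = true`), respectively at most one negative literal (`c = false`). -/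
def isHornFormula (c : Bool) (n h : Tm) : Fm :=
  -- `∀ d, d ∈ h → ∃ p q, d = (p, q) ∧ …`
  (elt ♯0 (h.up 1) ➔
    (♯2 ≐ pair ♯1 ♯0 ⋏ below ♯1 (n.up 3) ⋏ below ♯0 (n.up 3) ⋏
      atMostOne (if c then ♯1 else ♯0)).ex.ex).all

/-- The vector `v` satisfies the conjunction of clauses `h`. -/
def cnfTrue (h v : Tm) : Fm :=
  -- `∀ p q, (p, q) ∈ h → (∃ i, i ∈ p ∧ i ∈ v) ∨ (∃ i, i ∈ q ∧ i ∉ v)`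
  (elt (pair ♯1 ♯0) (h.up 2) ➔
    ((elt ♯0 ♯2 ⋏ elt ♯0 (v.up 3)).ex ⋎ (elt ♯0 ♯1 ⋏ (elt ♯0 (v.up 3)).neg).ex)).all.all

/-- `t` codes a Boolean relation that is defined by a horn (`c = true`), respectively co-horn
(`c = false`) formula. -/
def isHornRel (c : Bool) (t : Tm) : Fm :=
  -- `∃ n r h, t = (n, r) ∧ …`, and then `∀ v`
  (t.up 3 ≐ pair ♯2 ♯1 ⋏ isHornFormula c ♯2 ♯0 ⋏ (vecMem ♯3 ♯2 ♯0 ⟺ cnfTrue ♯1 ♯0).all).ex.ex.ex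

/-! For a relation `R` of arity `n`, the formula `R(y_0, …, y_{n-1})` is coded by `(R, y)`, where `y`
codes a finite set that contains, for each `i < n`, exactly one pair of the form `(i, z)`,
namely `(i, y_i)`.  Variables are the numbers in the set `V`. -/

/-- `t` is an `S`-formula over the set `V` of variables, where `S` is the class of (codes of)
relations defined by the formula `σ` in its number variable `0`.  The term `t` and the set variable
`V` live under `k` number quantifiers and `s` set quantifiers. -/
def isSFormula (σ : Fm) (k s : ℕ) (V : ℕ) (t : Tm) : Fm :=
  -- `∃ n r y, t = ((n, r), y) ∧ (n, r) ∈ S ∧ ∀ i, i < n → ∃ z, z ∈ V ∧ ∀ w, (i, w) ∈ y ↔ w = z`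
  (t.up 3 ≐ pair (pair ♯2 ♯1) ♯0 ⋏ σ.at (k + 3) s (pair ♯2 ♯1) ⋏
    (♯0 ≺ ♯3 ➔ (♯0 ε V ⋏ (elt (pair ♯2 ♯0) ♯3 ⟺ ♯0 ≐ ♯1).all).ex).all).ex.ex.ex

/-! A truth assignment is given by the set `X` of the variables to which it gives the value true. -/

/-- The assignment `X` satisfies the formula `t = R(y_0, …, y_{n-1})`. -/
def sat (X : ℕ) (t : Tm) : Fm :=
  -- `∃ n r y v, t = ((n, r), y) ∧ v ∈ (n, r) ∧ ∀ i, i < n → (i ∈ v ↔ ∃ z, (i, z) ∈ y ∧ z ∈ X)`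
  (t.up 4 ≐ pair (pair ♯3 ♯2) ♯1 ⋏ vecMem ♯3 ♯2 ♯0 ⋏
    (♯0 ≺ ♯4 ➔ (elt ♯0 ♯1 ⟺ (elt (pair ♯1 ♯0) ♯3 ⋏ ♯0 ε X).ex)).all).ex.ex.ex.ex

/-! ## The Ramsey-type satisfiability principle -/

def subset (X Y : ℕ) : Fm := (♯0 ε X ➔ ♯0 ε Y).all

/-- The class defined by `φ` in its number variable `0` is bounded. -/
def finClass (φ : Fm) : Fm :=
  -- `∃ b, ∀ x, φ(x) → x < b`
  (φ.at 2 0 ♯0 ➔ ♯0 ≺ ♯1).all.ex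

def finite (X : ℕ) : Fm := finClass (♯0 ε X)

def infinite (X : ℕ) : Fm := (finite X).neg

/-- The assignment `X` satisfies all formulas in the set `C`. -/
def satAll (X C : ℕ) : Fm := (♯0 ε C ➔ sat X ♯0).all

/-- Each finite subset of `C` is satisfiable. -/
def finSat (C : ℕ) : Fm :=
  -- `∀ F, F ⊆ C → F finite → ∃ X, X satisfies F`
  (subset 0 (C + 1) ➔ finite 0 ➔ (satAll 0 1).exS).allS

/-- The assignment `X` gives the value `c` to the variable `t`. -/
def hasValue (c : Bool) (X : ℕ) (t : Tm) : Fm := if c then t ε X else (t ε X).neg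

/-- `H` is homogeneous for `C` with color `c`. -/
def homogeneousWith (c : Bool) (H C : ℕ) : Fm :=
  -- `∀ F, F ⊆ C → F finite → ∃ X, X satisfies F ∧ ∀ a, a ∈ H → X(a) = c`
  (subset 0 (C + 1) ➔ finite 0 ➔
    (satAll 0 1 ⋏ (♯0 ε (H + 2) ➔ hasValue c 0 ♯0).all).exS).allS

def homogeneous (H C : ℕ) : Fm := homogeneousWith false H C ⋎ homogeneousWith true H C

/-- `(V, C, L)` (the set variables `2`, `1`, `0`) is an instance: `V` is infinite, `C` is a finitely
satisfiable set of `S`-formulas over `V`, and `L` is an infinite subset of `V`. -/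
def isInstance (σ : Fm) : Fm :=
  infinite 2 ⋏ (♯0 ε 1 ➔ isSFormula σ 1 3 2 ♯0).all ⋏ finSat 1 ⋏ infinite 0 ⋏ subset 0 2

/-- The principle `LRSAT(S)`, for the class `S` of relations defined by `σ` in its number
variable `0`. -/
def LRSAT (σ : Fm) : Fm :=
  -- `∀ V C L, (V, C, L) is an instance → ∃ H, …`
  (isInstance σ ➔ (infinite 0 ⋏ subset 0 1 ⋏ homogeneous 0 2).exS).allS.allS.allS

/-- Every relation in the class `S` defined by `σ` is horn (`c = true`), respectively co-horn
(`c = false`). -/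
def allHorn (c : Bool) (σ : Fm) : Fm := (σ ➔ isHornRel c ♯0).all

/-- The number variable `0` is in `L`, and some finite subset of `C` forces it to have the
value `c`. -/
def forced (c : Bool) (C L : ℕ) : Fm :=
  -- `x ∈ L ∧ ∃ F, F ⊆ C ∧ F finite ∧ ∀ X, X satisfies F → X(x) = c`
  ♯0 ε L ⋏ (subset 0 (C + 1) ⋏ finite 0 ⋏ (satAll 0 1 ➔ hasValue c 0 ♯0).allS).exS

/-- For each instance `(V, C, L)` of `LRSAT(S)`, the class of the `x ∈ L` that are forced to have
the value `c` is defined by `θ`, and there is an infinite set `H ⊆ L` for which one of the following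
holds: this class is infinite, it contains `H`, and `H` is homogeneous for `C` with color `c`; or
this class is finite, `H` is its complement in `L`, and `H` is homogeneous for `C` with the other
color.  (In `θ`, the number variable `0` is `x`, and the set variables `2`, `1`, `0` are `V`, `C`,
`L`.) -/
def LRSATForced (c : Bool) (θ σ : Fm) : Fm :=
  (isInstance σ ➔
    (θ ⟺ forced c 1 0).all ⋏
    (infinite 0 ⋏ subset 0 1 ⋏
      (((finClass (forced c 2 1)).neg ⋏ (♯0 ε 0 ➔ forced c 2 1).all ⋏ homogeneousWith c 0 2) ⋎
        (finClass (forced c 2 1) ⋏ (♯0 ε 0 ⟺ (♯0 ε 1 ⋏ (forced c 2 1).neg)).all ⋏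
          homogeneousWith (!c) 0 2))).exS).allS.allS.allS

end SOA

open SOA

/-! By the completeness theorem, the principle has to be verified in an arbitrary, possibly
nonstandard, model of `RCA0`.

A horn (co-horn) relation is closed under intersection (union) of assignments, and so is the set of
assignments that satisfy `C`.  Whether an assignment satisfies the formulas with code below `k`
depends only on its restriction to `[0, k)`, and these restrictions have codes below a bound `B`
that is recognized by a bounded formula.  So it is a bounded property of `k` and `B` that the
formulas in `C` below `k` force `x` to have the value `c`, and the class `F` of the forced variables
is `Σ⁰₁`.

If `F` is infinite, then it has an infinite subset `H`, by `Δ⁰₁` comprehension.  By `Σ⁰₁`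
collection, finitely many formulas force all of `H ∩ [0, b)`, and each assignment that satisfies
them gives the value `c` on `H ∩ [0, b)`.  If `F` is finite, then `H = L \ F` exists by bounded
`Σ⁰₁` comprehension.  Given finitely many formulas, each `x` in `H` has the value `1 - c` in some
assignment that satisfies them; the intersection (union) of these assignments over all `x` in
`H ∩ [0, b)`, taken by bounded induction, gives the value `1 - c` on `H ∩ [0, b)`. -/

namespace SOA

/-! ## Substitution -/

theorem Tm.subst_subst (t : Tm) (e e' : ℕ → Tm) :
    (t.subst e).subst e' = t.subst fun i => (e i).subst e' := by
  induction t <;> simp_all [Tm.subst]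

theorem Tm.subst_var (t : Tm) : t.subst Tm.var = t := by
  induction t <;> simp_all [Tm.subst]

theorem Tm.up_inst (t u : Tm) : (t.up 1).subst (scons u Tm.var) = t := by
  rw [Tm.up, Tm.subst_subst]; exact t.subst_var

/-- Substitution under a number quantifier. -/
def liftTm (e : ℕ → Tm) : ℕ → Tm := scons ♯0 fun i => (e i).up 1

/-- Renaming under a set quantifier. -/
def liftSet (f : ℕ → ℕ) : ℕ → ℕ := scons 0 fun i => f i + 1

theorem liftTm_comp (e e' : ℕ → Tm) :
    (fun i => (liftTm e i).subst (liftTm e')) = liftTm fun i => (e i).subst e' := by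
  funext i
  cases i <;> simp [liftTm, scons, Tm.up, Tm.subst, Tm.subst_subst]

theorem liftSet_comp (f f' : ℕ → ℕ) : liftSet f' ∘ liftSet f = liftSet (f' ∘ f) := by
  funext i
  cases i <;> simp [liftSet, scons]

theorem liftTm_var : liftTm Tm.var = Tm.var := by
  funext i
  cases i <;> rfl

theorem liftSet_id : liftSet id = id := by
  funext i
  cases i <;> rfl

theorem Fm.subst_all (φ : Fm) (e : ℕ → Tm) (f : ℕ → ℕ) :
    φ.all.subst e f = (φ.subst (liftTm e) f).all := rfl

theorem Fm.subst_allS (φ : Fm) (e : ℕ → Tm) (f : ℕ → ℕ) :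
    φ.allS.subst e f = (φ.subst e (liftSet f)).allS := rfl

theorem Fm.subst_subst (φ : Fm) (e e' : ℕ → Tm) (f f' : ℕ → ℕ) :
    (φ.subst e f).subst e' f' = φ.subst (fun i => (e i).subst e') (f' ∘ f) := by
  induction φ generalizing e e' f f' with
  | all φ ih => simp only [Fm.subst_all, ih, liftTm_comp]
  | allS φ ih => simp only [Fm.subst_allS, ih, liftSet_comp]
  | _ => simp_all [Fm.subst, Tm.subst_subst]

theorem Fm.subst_id (φ : Fm) : φ.subst Tm.var id = φ := by
  induction φ with
  | all φ ih => rw [Fm.subst_all, liftTm_var, ih]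
  | allS φ ih => rw [Fm.subst_allS, liftSet_id, ih]
  | _ => simp_all [Fm.subst, Tm.subst_var]

theorem Fm.wk_subst (φ : Fm) (e : ℕ → Tm) (f : ℕ → ℕ) :
    φ.wk.subst (liftTm e) f = (φ.subst e f).wk := by
  simp only [Fm.wk, Fm.subst_subst]; rfl

theorem Fm.wkS_subst (φ : Fm) (e : ℕ → Tm) (f : ℕ → ℕ) :
    φ.wkS.subst e (liftSet f) = (φ.subst e f).wkS := by
  simp only [Fm.wkS, Fm.subst_subst, Tm.subst_var]; rfl

theorem Fm.inst_subst (φ : Fm) (t : Tm) (e : ℕ → Tm) (f : ℕ → ℕ) :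
    (φ.inst t).subst e f = (φ.subst (liftTm e) f).inst (t.subst e) := by
  simp only [Fm.inst, Fm.subst_subst]
  congr 1
  funext i
  cases i with
  | zero => rfl
  | succ i => exact ((e i).up_inst _).symm

theorem Fm.instS_subst (φ : Fm) (X : ℕ) (e : ℕ → Tm) (f : ℕ → ℕ) :
    (φ.instS X).subst e f = (φ.subst e (liftSet f)).instS (f X) := by
  simp only [Fm.instS, Fm.subst_subst, Tm.subst_var]
  congr 1
  funext i
  cases i <;> rfl

theorem Fm.subst_lift_inst (φ : Fm) (e : ℕ → Tm) (f : ℕ → ℕ) (t : Tm) :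
    (φ.subst (liftTm e) f).inst t = φ.subst (scons t e) f := by
  simp only [Fm.inst, Fm.subst_subst]
  congr 1
  funext i
  cases i with
  | zero => rfl
  | succ i => exact (e i).up_inst t

theorem Fm.subst_lift_instS (φ : Fm) (e : ℕ → Tm) (f : ℕ → ℕ) (X : ℕ) :
    (φ.subst e (liftSet f)).instS X = φ.subst e (scons X f) := by
  simp only [Fm.instS, Fm.subst_subst, Tm.subst_var]
  congr 1
  funext i
  cases i <;> rfl

/-- All variables that are free in `t` are less than `t.bound`. -/
def Tm.bound : Tm → ℕ
  | .var i => i + 1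
  | .zero | .one => 0
  | .add t u | .mul t u => max t.bound u.bound

/-- All variables, of both sorts, that are free in `φ` are less than `φ.bound`.  (The bound is not
lowered at quantifiers.) -/
def Fm.bound : Fm → ℕ
  | .eq t u | .lt t u => max t.bound u.bound
  | .mem t X => max t.bound (X + 1)
  | .cls t => t.bound
  | .bot => 0
  | .imp φ ψ => max φ.bound ψ.bound
  | .all φ | .allS φ => φ.bound

theorem Tm.subst_congr (t : Tm) {e e' : ℕ → Tm} (he : ∀ i < t.bound, e i = e' i) :
    t.subst e = t.subst e' := by
  induction t with
  | var i => exact he i i.lt_succ_self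
  | zero | one => rfl
  | add t u ht hu | mul t u ht hu =>
    rw [Tm.subst, Tm.subst, ht fun i hi => he i (lt_max_of_lt_left hi),
      hu fun i hi => he i (lt_max_of_lt_right hi)]

theorem liftTm_congr {n : ℕ} {e e' : ℕ → Tm} (he : ∀ i < n, e i = e' i) :
    ∀ i < n, liftTm e i = liftTm e' i
  | 0, _ => rfl
  | i + 1, hi => by simp only [liftTm, scons, he i (by omega)]

theorem liftSet_congr {n : ℕ} {f f' : ℕ → ℕ} (hf : ∀ i < n, f i = f' i) :
    ∀ i < n, liftSet f i = liftSet f' i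
  | 0, _ => rfl
  | i + 1, hi => by simp only [liftSet, scons, hf i (by omega)]

theorem Fm.subst_congr (φ : Fm) {e e' : ℕ → Tm} {f f' : ℕ → ℕ} (he : ∀ i < φ.bound, e i = e' i)
    (hf : ∀ i < φ.bound, f i = f' i) : φ.subst e f = φ.subst e' f' := by
  induction φ generalizing e e' f f' with
  | eq t u | lt t u =>
    rw [Fm.subst, Fm.subst, t.subst_congr fun i hi => he i (lt_max_of_lt_left hi),
      u.subst_congr fun i hi => he i (lt_max_of_lt_right hi)]
  | mem t X =>
    rw [Fm.subst, Fm.subst, t.subst_congr fun i hi => he i (lt_max_of_lt_left hi),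
      hf X (lt_max_of_lt_right X.lt_succ_self)]
  | cls t => rw [Fm.subst, Fm.subst, t.subst_congr he]
  | bot => rfl
  | imp φ ψ hφ hψ =>
    rw [Fm.subst, Fm.subst,
      hφ (fun i hi => he i (lt_max_of_lt_left hi)) fun i hi => hf i (lt_max_of_lt_left hi),
      hψ (fun i hi => he i (lt_max_of_lt_right hi)) fun i hi => hf i (lt_max_of_lt_right hi)]
  | all φ ih => rw [Fm.subst_all, Fm.subst_all, ih (liftTm_congr he) hf]
  | allS φ ih => rw [Fm.subst_allS, Fm.subst_allS, ih he (liftSet_congr hf)]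

theorem Fm.exists_forall_bound_le (Γ : List Fm) : ∃ n, ∀ φ ∈ Γ, φ.bound ≤ n :=
  ⟨(Γ.map Fm.bound).foldr max 0, fun _ hφ => List.le_max_of_le' 0 (List.mem_map_of_mem hφ) le_rfl⟩

/-! ## Derivations and consistency -/

section Derivations

variable {T : Set Fm}

theorem Derives.mono {Γ Δ : List Fm} {φ : Fm} (h : Derives T Γ φ) (hΔ : Γ ⊆ Δ) :
    Derives T Δ φ := by
  induction h generalizing Δ with
  | ax h e f => exact .ax h e f
  | hyp h => exact .hyp (hΔ h)
  | impI _ ih => exact .impI (ih (List.cons_subset_cons _ hΔ))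
  | impE _ _ ih ih' => exact .impE (ih hΔ) (ih' hΔ)
  | contra _ ih => exact .contra (ih (List.cons_subset_cons _ hΔ))
  | allI _ ih => exact .allI (ih (List.map_subset _ hΔ))
  | allE _ t ih => exact .allE (ih hΔ) t
  | allSI _ ih => exact .allSI (ih (List.map_subset _ hΔ))
  | allSE _ X ih => exact .allSE (ih hΔ) X
  | eqI t => exact .eqI t
  | eqE φ _ _ ih ih' => exact .eqE φ (ih hΔ) (ih' hΔ)

theorem Derives.subst {Γ : List Fm} {φ : Fm} (h : Derives T Γ φ) (e : ℕ → Tm) (f : ℕ → ℕ) :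
    Derives T (Γ.map (Fm.subst e f)) (φ.subst e f) := by
  induction h generalizing e f with
  | ax h e' f' => rw [Fm.subst_subst]; exact .ax h _ _
  | hyp h => exact .hyp (List.mem_map_of_mem h)
  | impI _ ih => exact .impI (ih e f)
  | impE _ _ ih ih' => exact .impE (ih e f) (ih' e f)
  | contra _ ih => exact .contra (ih e f)
  | allI _ ih =>
    refine .allI (φ := Fm.subst (liftTm e) f _) ?_
    simpa only [List.map_map, Function.comp_def, Fm.wk_subst] using ih (liftTm e) f
  | allE _ t ih => rw [Fm.inst_subst]; exact .allE (ih e f) _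
  | allSI _ ih =>
    refine .allSI (φ := Fm.subst e (liftSet f) _) ?_
    simpa only [List.map_map, Function.comp_def, Fm.wkS_subst] using ih e (liftSet f)
  | allSE _ X ih => rw [Fm.instS_subst]; exact .allSE (ih e f) _
  | eqI t => exact .eqI _
  | eqE φ _ _ ih ih' =>
    simp only [Fm.inst_subst] at ih' ⊢
    exact .eqE _ (ih e f) (ih' e f)

theorem Derives.ex_falso {Γ : List Fm} (h : Derives T Γ .bot) (φ : Fm) : Derives T Γ φ :=
  .contra (h.mono (List.subset_cons_self _ _))

/-- The list `Γ` of assumptions is consistent with the axioms `T`. -/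
def Consistent (T : Set Fm) (Γ : List Fm) : Prop := ¬ Derives T Γ .bot

theorem Consistent.or_neg {Γ : List Fm} (h : Consistent T Γ) (φ : Fm) :
    Consistent T (φ :: Γ) ∨ Consistent T (φ.neg :: Γ) := by
  by_contra! hc
  simp only [Consistent, not_not] at hc
  exact h (.impE (.impI hc.1) (.contra hc.2))

-- A variable `n` that occurs nowhere is a witness: substituting `♯0` for it and shifting the other
-- variables turns a derivation of `φ.inst ♯n` into one of `φ` from the weakened assumptions.
theorem Consistent.exists_witness {Γ : List Fm} {φ : Fm} (h : Consistent T (φ.all.neg :: Γ)) :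
    ∃ n, Consistent T ((φ.inst ♯n).neg :: φ.all.neg :: Γ) := by
  obtain ⟨n, hn⟩ := Fm.exists_forall_bound_le (φ :: φ.all.neg :: Γ)
  refine ⟨n, fun hd => h (.impE (.hyp List.mem_cons_self) (.allI ?_))⟩
  convert (Derives.contra hd).subst (fun i => if i = n then ♯0 else ♯(i + 1)) id using 1
  · refine List.map_congr_left fun ψ hψ => ψ.subst_congr (fun i hi => ?_) fun _ _ => rfl
    simp [(hi.trans_le (hn ψ (List.mem_cons_of_mem _ hψ))).ne]
  · rw [Fm.inst, Fm.subst_subst]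
    refine φ.subst_id.symm.trans (φ.subst_congr (fun i hi => ?_) fun _ _ => rfl)
    have hi : i < n := hi.trans_le (hn φ List.mem_cons_self)
    cases i with
    | zero => simp [scons, Tm.subst]
    | succ i => simp [scons, Tm.subst, show i ≠ n by omega]

theorem Consistent.exists_witnessS {Γ : List Fm} {φ : Fm} (h : Consistent T (φ.allS.neg :: Γ)) :
    ∃ n, Consistent T ((φ.instS n).neg :: φ.allS.neg :: Γ) := by
  obtain ⟨n, hn⟩ := Fm.exists_forall_bound_le (φ :: φ.allS.neg :: Γ)
  refine ⟨n, fun hd => h (.impE (.hyp List.mem_cons_self) (.allSI ?_))⟩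
  convert (Derives.contra hd).subst Tm.var (fun i => if i = n then 0 else i + 1) using 1
  · refine List.map_congr_left fun ψ hψ => ψ.subst_congr (fun _ _ => rfl) fun i hi => ?_
    simp [(hi.trans_le (hn ψ (List.mem_cons_of_mem _ hψ))).ne]
  · rw [Fm.instS, Fm.subst_subst]
    refine φ.subst_id.symm.trans (φ.subst_congr (fun _ _ => rfl) fun i hi => ?_)
    have hi : i < n := hi.trans_le (hn φ List.mem_cons_self)
    cases i with
    | zero => simp [scons]
    | succ i => simp [scons, show i ≠ n by omega]

/-- `Δ` decides `φ`, with a witness if `φ` is a refuted universal formula. -/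
def Decides (Δ : List Fm) (φ : Fm) : Prop :=
  φ ∈ Δ ∨ φ.neg ∈ Δ ∧ (∀ ψ, φ = .all ψ → ∃ n, (ψ.inst ♯n).neg ∈ Δ) ∧
    ∀ ψ, φ = .allS ψ → ∃ n, (ψ.instS n).neg ∈ Δ

theorem Consistent.exists_decides {Γ : List Fm} (h : Consistent T Γ) (φ : Fm) :
    ∃ Δ, Γ ⊆ Δ ∧ Consistent T Δ ∧ Decides Δ φ := by
  rcases h.or_neg φ with hφ | hφ
  · exact ⟨_, List.subset_cons_self _ _, hφ, .inl List.mem_cons_self⟩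
  cases φ with
  | all ψ =>
    obtain ⟨n, hn⟩ := hφ.exists_witness
    exact ⟨_, by simp, hn, .inr ⟨by simp, fun _ h => ⟨n, by cases h; simp⟩, nofun⟩⟩
  | allS ψ =>
    obtain ⟨n, hn⟩ := hφ.exists_witnessS
    exact ⟨_, by simp, hn, .inr ⟨by simp, nofun, fun _ h => ⟨n, by cases h; simp⟩⟩⟩
  | _ => exact ⟨_, List.subset_cons_self _ _, hφ, .inr ⟨List.mem_cons_self, nofun, nofun⟩⟩

end Derivations

deriving instance Countable for Tm

deriving instance Countable for Fm

instance : Nonempty Fm := ⟨.bot⟩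

/-! ## Structures -/

/-- A structure for the two-sorted language.  Only the sort of sets has to be required to be
nonempty, as `0` is a number. -/
structure Str where
  Dom : Type
  Sets : Type
  zero : Dom
  one : Dom
  add : Dom → Dom → Dom
  mul : Dom → Dom → Dom
  lt : Dom → Dom → Prop
  mem : Dom → Sets → Prop
  cls : Dom → Prop
  nonempty : Nonempty Sets

namespace Str

variable (N : Str)

instance : Zero N.Dom := ⟨N.zero⟩
instance : One N.Dom := ⟨N.one⟩
instance : Add N.Dom := ⟨N.add⟩
instance : Mul N.Dom := ⟨N.mul⟩
instance : LT N.Dom := ⟨N.lt⟩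
instance : Membership N.Dom N.Sets := ⟨fun X x => N.mem x X⟩

end Str

/-- The value of a term in the structure `N`, under the assignment `e` to the number variables. -/
def Tm.val {N : Str} (e : ℕ → N.Dom) : Tm → N.Dom
  | .var i => e i
  | .zero => 0
  | .one => 1
  | .add t u => t.val e + u.val e
  | .mul t u => t.val e * u.val e

/-- Tarskian truth of a formula in the structure `N`, under the assignments `e` to the number
variables and `f` to the set variables. -/
def Fm.Holds {N : Str} : (ℕ → N.Dom) → (ℕ → N.Sets) → Fm → Prop
  | e, _, .eq t u => t.val e = u.val e
  | e, _, .lt t u => t.val e < u.val e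
  | e, f, .mem t X => t.val e ∈ f X
  | e, _, .cls t => N.cls (t.val e)
  | _, _, .bot => False
  | e, f, .imp φ ψ => φ.Holds e f → ψ.Holds e f
  | e, f, .all φ => ∀ x, φ.Holds (scons x e) f
  | e, f, .allS φ => ∀ X, φ.Holds e (scons X f)

/-- `N` is a model of the theory `T`, whose free variables are read as universally quantified. -/
def Str.Models (N : Str) (T : Set Fm) : Prop := ∀ φ ∈ T, ∀ e f, φ.Holds (N := N) e f

/-! ## Completeness -/

/-- An increasing sequence of consistent lists of formulas that decides every formula. -/
structure IsHenkinChain (T : Set Fm) (Γ : ℕ → List Fm) : Prop where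
  mono : ∀ {m n}, m ≤ n → Γ m ⊆ Γ n
  consistent : ∀ n, Consistent T (Γ n)
  decides : ∀ φ, ∃ n, Decides (Γ n) φ

theorem Consistent.exists_isHenkinChain {T : Set Fm} {Γ : List Fm} (h : Consistent T Γ) :
    ∃ Γ' : ℕ → List Fm, Γ' 0 = Γ ∧ IsHenkinChain T Γ' := by
  obtain ⟨enum, henum⟩ := exists_surjective_nat Fm
  choose! next hsub hcon hdec using
    fun (Δ : List Fm) (φ : Fm) (hΔ : Consistent T Δ) => hΔ.exists_decides φ
  let chain : ℕ → List Fm := fun n => n.rec Γ fun k Δ => next Δ (enum k)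
  have hchain : ∀ n, Consistent T (chain n) := fun n => by
    induction n with
    | zero => exact h
    | succ n ih => exact hcon _ _ ih
  refine ⟨chain, rfl, fun {m n} hmn => ?_, hchain, fun φ => ?_⟩
  · induction hmn with
    | refl => exact List.Subset.refl _
    | step _ ih => exact List.Subset.trans ih (hsub _ _ (hchain _))
  · obtain ⟨n, rfl⟩ := henum φ
    exact ⟨n + 1, hdec _ _ (hchain n)⟩

/-- The formulas that are derivable from some member of a sequence of lists of assumptions. -/
def limitTheory (T : Set Fm) (Γ : ℕ → List Fm) : Set Fm := {φ | ∃ n, Derives T (Γ n) φ}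

/-- A complete Henkin theory `Δ` that extends `T`. -/
structure IsHenkin (T : Set Fm) (Δ : Set Fm) : Prop where
  ax : ∀ φ ∈ T, ∀ e f, φ.subst e f ∈ Δ
  bot : Fm.bot ∉ Δ
  imp : ∀ {φ ψ}, (φ ➔ ψ) ∈ Δ ↔ (φ ∈ Δ → ψ ∈ Δ)
  all : ∀ {φ}, Fm.all φ ∈ Δ ↔ ∀ t, φ.inst t ∈ Δ
  allS : ∀ {φ}, Fm.allS φ ∈ Δ ↔ ∀ X, φ.instS X ∈ Δ
  eqI : ∀ t, (t ≐ t) ∈ Δ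
  eqE : ∀ {t u} (φ : Fm), (t ≐ u) ∈ Δ → φ.inst t ∈ Δ → φ.inst u ∈ Δ

namespace IsHenkinChain

variable {T : Set Fm} {Γ : ℕ → List Fm} {φ ψ : Fm}

theorem mem_limitTheory {n : ℕ} (h : φ ∈ Γ n) : φ ∈ limitTheory T Γ := ⟨n, .hyp h⟩

theorem mem_limitTheory_of_imp (hΓ : IsHenkinChain T Γ) :
    (φ ➔ ψ) ∈ limitTheory T Γ → φ ∈ limitTheory T Γ → ψ ∈ limitTheory T Γ
  | ⟨m, hm⟩, ⟨n, hn⟩ =>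
    ⟨max m n, .impE (hm.mono (hΓ.mono (le_max_left ..))) (hn.mono (hΓ.mono (le_max_right ..)))⟩

theorem bot_notMem_limitTheory (hΓ : IsHenkinChain T Γ) : Fm.bot ∉ limitTheory T Γ :=
  fun ⟨n, hn⟩ => hΓ.consistent n hn

theorem notMem_limitTheory_of_neg (hΓ : IsHenkinChain T Γ) (h : φ.neg ∈ limitTheory T Γ) :
    φ ∉ limitTheory T Γ :=
  fun hφ => hΓ.bot_notMem_limitTheory (hΓ.mem_limitTheory_of_imp h hφ)

theorem imp_mem_limitTheory (hΓ : IsHenkinChain T Γ)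
    (h : φ ∈ limitTheory T Γ → ψ ∈ limitTheory T Γ) : (φ ➔ ψ) ∈ limitTheory T Γ := by
  obtain ⟨n, hn | hn⟩ := hΓ.decides φ
  · obtain ⟨m, hm⟩ := h (mem_limitTheory hn)
    exact ⟨m, .impI (hm.mono (List.subset_cons_self _ _))⟩
  · exact ⟨n, .impI (.ex_falso (.impE (.hyp (List.mem_cons_of_mem _ hn.1))
      (.hyp List.mem_cons_self)) _)⟩

theorem all_mem_limitTheory (hΓ : IsHenkinChain T Γ) (h : ∀ t, φ.inst t ∈ limitTheory T Γ) :
    φ.all ∈ limitTheory T Γ := by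
  obtain ⟨n, hn | ⟨-, hn, -⟩⟩ := hΓ.decides φ.all
  · exact mem_limitTheory hn
  · obtain ⟨k, hk⟩ := hn φ rfl
    exact absurd (h ♯k) (hΓ.notMem_limitTheory_of_neg (mem_limitTheory hk))

theorem allS_mem_limitTheory (hΓ : IsHenkinChain T Γ) (h : ∀ X, φ.instS X ∈ limitTheory T Γ) :
    φ.allS ∈ limitTheory T Γ := by
  obtain ⟨n, hn | ⟨-, -, hn⟩⟩ := hΓ.decides φ.allS
  · exact mem_limitTheory hn
  · obtain ⟨k, hk⟩ := hn φ rfl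
    exact absurd (h k) (hΓ.notMem_limitTheory_of_neg (mem_limitTheory hk))

theorem isHenkin_limitTheory (hΓ : IsHenkinChain T Γ) : IsHenkin T (limitTheory T Γ) where
  ax _ hφ e f := ⟨0, .ax hφ e f⟩
  bot := hΓ.bot_notMem_limitTheory
  imp := ⟨hΓ.mem_limitTheory_of_imp, hΓ.imp_mem_limitTheory⟩
  all := ⟨fun ⟨n, hn⟩ t => ⟨n, .allE hn t⟩, hΓ.all_mem_limitTheory⟩
  allS := ⟨fun ⟨n, hn⟩ X => ⟨n, .allSE hn X⟩, hΓ.allS_mem_limitTheory⟩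
  eqI t := ⟨0, .eqI t⟩
  eqE φ := fun ⟨m, hm⟩ ⟨n, hn⟩ => ⟨max m n, .eqE φ (hm.mono (hΓ.mono (le_max_left ..)))
    (hn.mono (hΓ.mono (le_max_right ..)))⟩

end IsHenkinChain

namespace IsHenkin

variable {T Δ : Set Fm} {t t' u u' : Tm}

theorem eq_symm (hΔ : IsHenkin T Δ) (h : (t ≐ u) ∈ Δ) : (u ≐ t) ∈ Δ := by
  have hsub := hΔ.eqE (♯0 ≐ t.up 1) h
  simp only [Fm.inst, Fm.subst, Tm.up_inst] at hsub
  exact hsub (hΔ.eqI t)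

theorem eq_trans (hΔ : IsHenkin T Δ) (h : (t ≐ t') ∈ Δ) (h' : (t' ≐ u) ∈ Δ) : (t ≐ u) ∈ Δ := by
  have hsub := hΔ.eqE (t.up 1 ≐ ♯0) h'
  simp only [Fm.inst, Fm.subst, Tm.up_inst] at hsub
  exact hsub h

/-- Equality of terms in a Henkin theory. -/
def setoid (hΔ : IsHenkin T Δ) : Setoid Tm where
  r t u := (t ≐ u) ∈ Δ
  iseqv := ⟨hΔ.eqI, hΔ.eq_symm, hΔ.eq_trans⟩

theorem add_congr (hΔ : IsHenkin T Δ) (ht : (t ≐ t') ∈ Δ) (hu : (u ≐ u') ∈ Δ) :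
    (t.add u ≐ t'.add u') ∈ Δ := by
  have hleft := hΔ.eqE ((t.up 1).add (u.up 1) ≐ Tm.add ♯0 (u.up 1)) ht
  have hright := hΔ.eqE ((t.up 1).add (u.up 1) ≐ (t'.up 1).add ♯0) hu
  simp only [Fm.inst, Fm.subst, Tm.subst, Tm.up_inst] at hleft hright
  exact hright (hleft (hΔ.eqI _))

theorem mul_congr (hΔ : IsHenkin T Δ) (ht : (t ≐ t') ∈ Δ) (hu : (u ≐ u') ∈ Δ) :
    (t.mul u ≐ t'.mul u') ∈ Δ := by
  have hleft := hΔ.eqE ((t.up 1).mul (u.up 1) ≐ Tm.mul ♯0 (u.up 1)) ht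
  have hright := hΔ.eqE ((t.up 1).mul (u.up 1) ≐ (t'.up 1).mul ♯0) hu
  simp only [Fm.inst, Fm.subst, Tm.subst, Tm.up_inst] at hleft hright
  exact hright (hleft (hΔ.eqI _))

theorem lt_congr (hΔ : IsHenkin T Δ) (ht : (t ≐ t') ∈ Δ) (hu : (u ≐ u') ∈ Δ)
    (h : (t ≺ u) ∈ Δ) : (t' ≺ u') ∈ Δ := by
  have hleft := hΔ.eqE (♯0 ≺ u.up 1) ht
  have hright := hΔ.eqE (t'.up 1 ≺ ♯0) hu
  simp only [Fm.inst, Fm.subst, Tm.up_inst] at hleft hright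
  exact hright (hleft h)

theorem mem_congr (hΔ : IsHenkin T Δ) (X : ℕ) (ht : (t ≐ t') ∈ Δ) (h : (t ε X) ∈ Δ) :
    (t' ε X) ∈ Δ :=
  hΔ.eqE (♯0 ε X) ht h

theorem cls_congr (hΔ : IsHenkin T Δ) (ht : (t ≐ t') ∈ Δ) (h : Fm.cls t ∈ Δ) : Fm.cls t' ∈ Δ :=
  hΔ.eqE (Fm.cls ♯0) ht h

/-- The term model of a Henkin theory. -/
def model (hΔ : IsHenkin T Δ) : Str where
  Dom := Quotient hΔ.setoid
  Sets := ℕ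
  zero := Quotient.mk _ .zero
  one := Quotient.mk _ .one
  add := Quotient.map₂ Tm.add fun _ _ h _ _ h' => hΔ.add_congr h h'
  mul := Quotient.map₂ Tm.mul fun _ _ h _ _ h' => hΔ.mul_congr h h'
  lt := Quotient.lift₂ (fun t u => (t ≺ u) ∈ Δ) fun _ _ _ _ h h' => propext
    ⟨hΔ.lt_congr h h', hΔ.lt_congr (hΔ.eq_symm h) (hΔ.eq_symm h')⟩
  mem x X := Quotient.lift (fun t => (t ε X) ∈ Δ) (fun _ _ h => propext
    ⟨hΔ.mem_congr X h, hΔ.mem_congr X (hΔ.eq_symm h)⟩) x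
  cls := Quotient.lift (fun t => Fm.cls t ∈ Δ) fun _ _ h => propext
    ⟨hΔ.cls_congr h, hΔ.cls_congr (hΔ.eq_symm h)⟩
  nonempty := ⟨(0 : ℕ)⟩

/-- The element of the term model denoted by a term. -/
def den (hΔ : IsHenkin T Δ) (t : Tm) : hΔ.model.Dom := Quotient.mk hΔ.setoid t

theorem den_surjective (hΔ : IsHenkin T Δ) : Function.Surjective hΔ.den := Quotient.mk_surjective

theorem val_den (hΔ : IsHenkin T Δ) (t : Tm) (e : ℕ → Tm) :
    t.val (fun i => hΔ.den (e i)) = hΔ.den (t.subst e) := by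
  induction t with
  | add t u ht hu | mul t u ht hu => simp only [Tm.val, ht, hu]; rfl
  | _ => rfl

theorem holds_iff (hΔ : IsHenkin T Δ) (φ : Fm) (e : ℕ → Tm) (f : ℕ → ℕ) :
    φ.Holds (N := hΔ.model) (fun i => hΔ.den (e i)) f ↔ φ.subst e f ∈ Δ := by
  induction φ generalizing e f with
  | eq t u =>
    simp only [Fm.Holds, val_den, Fm.subst]
    exact Quotient.eq (r := hΔ.setoid)
  | lt t u => simp only [Fm.Holds, val_den, Fm.subst]; rfl
  | mem t X => simp only [Fm.Holds, val_den, Fm.subst]; rfl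
  | cls t => simp only [Fm.Holds, val_den, Fm.subst]; rfl
  | bot => simp only [Fm.Holds, Fm.subst, hΔ.bot]
  | imp φ ψ hφ hψ => simp only [Fm.Holds, Fm.subst, hΔ.imp, hφ, hψ]
  | all φ ih =>
    simp only [Fm.Holds, Fm.subst_all, hΔ.all, Fm.subst_lift_inst, ← ih, hΔ.den_surjective.forall]
    refine forall_congr' fun t => ?_
    rw [show scons (hΔ.den t) (fun i => hΔ.den (e i)) = fun i => hΔ.den (scons t e i) from
      funext fun i => by cases i <;> rfl]
  | allS φ ih =>
    simp only [Fm.Holds, Fm.subst_allS, hΔ.allS, Fm.subst_lift_instS, ← ih]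
    rfl

theorem model_models (hΔ : IsHenkin T Δ) : hΔ.model.Models T := by
  intro φ hφ e f
  obtain ⟨e', rfl⟩ := hΔ.den_surjective.comp_left e
  exact (hΔ.holds_iff φ e' f).2 (hΔ.ax φ hφ e' f)

end IsHenkin

theorem proves_of_models {T : Set Fm} {φ : Fm}
    (h : ∀ N : Str, N.Models T → ∀ e f, φ.Holds (N := N) e f) : Proves T φ := by
  by_contra hφ
  have hcon : Consistent T [φ.neg] := fun hd => hφ (.contra hd)
  obtain ⟨Γ, hΓ, hchain⟩ := hcon.exists_isHenkinChain
  have hΔ := hchain.isHenkin_limitTheory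
  have hmem := (hΔ.holds_iff φ Tm.var id).1 (h hΔ.model hΔ.model_models _ _)
  rw [Fm.subst_id] at hmem
  refine hchain.notMem_limitTheory_of_neg ?_ hmem
  exact IsHenkinChain.mem_limitTheory (n := 0) (hΓ ▸ List.mem_cons_self)

section Evaluation

variable {N : Str} (e : ℕ → N.Dom) (f : ℕ → N.Sets)

@[simp] theorem scons_zero {α : Type} (a : α) (g : ℕ → α) : scons a g 0 = a := rfl
@[simp] theorem scons_succ {α : Type} (a : α) (g : ℕ → α) (i : ℕ) : scons a g (i + 1) = g i := rfl

@[simp] theorem Tm.val_var (i : ℕ) : (♯i).val e = e i := rfl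
@[simp] theorem Tm.val_zero : (0 : Tm).val e = 0 := rfl
@[simp] theorem Tm.val_one : (1 : Tm).val e = 1 := rfl
@[simp] theorem Tm.val_add (t u : Tm) : (t + u).val e = t.val e + u.val e := rfl
@[simp] theorem Tm.val_mul (t u : Tm) : (t * u).val e = t.val e * u.val e := rfl

theorem Tm.val_subst (t : Tm) (s : ℕ → Tm) : (t.subst s).val e = t.val fun i => (s i).val e := by
  induction t <;> simp_all [Tm.subst, Tm.val]

@[simp] theorem Tm.val_up (t : Tm) (k : ℕ) : (t.up k).val e = t.val fun i => e (i + k) :=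
  t.val_subst e _

@[simp] theorem Fm.holds_eq (t u : Tm) : (t ≐ u).Holds e f ↔ t.val e = u.val e := Iff.rfl
@[simp] theorem Fm.holds_lt (t u : Tm) : (t ≺ u).Holds e f ↔ t.val e < u.val e := Iff.rfl
@[simp] theorem Fm.holds_mem (t : Tm) (X : ℕ) : (t ε X).Holds e f ↔ t.val e ∈ f X := Iff.rfl
@[simp] theorem Fm.holds_imp (φ ψ : Fm) : (φ ➔ ψ).Holds e f ↔ (φ.Holds e f → ψ.Holds e f) := Iff.rfl
@[simp] theorem Fm.holds_all (φ : Fm) : φ.all.Holds e f ↔ ∀ x, φ.Holds (scons x e) f := Iff.rfl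
@[simp] theorem Fm.holds_allS (φ : Fm) : φ.allS.Holds e f ↔ ∀ X, φ.Holds e (scons X f) := Iff.rfl
@[simp] theorem Fm.holds_neg (φ : Fm) : φ.neg.Holds e f ↔ ¬ φ.Holds e f := Iff.rfl

@[simp] theorem Fm.holds_and (φ ψ : Fm) : (φ ⋏ ψ).Holds e f ↔ φ.Holds e f ∧ ψ.Holds e f := by
  simp [Fm.and]

@[simp] theorem Fm.holds_or (φ ψ : Fm) : (φ ⋎ ψ).Holds e f ↔ φ.Holds e f ∨ ψ.Holds e f := by
  simp only [Fm.or, Fm.holds_neg, Fm.holds_imp]; tauto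

@[simp] theorem Fm.holds_iff (φ ψ : Fm) : (φ ⟺ ψ).Holds e f ↔ (φ.Holds e f ↔ ψ.Holds e f) := by
  simp only [Fm.iff, Fm.holds_and, Fm.holds_imp]; tauto

@[simp] theorem Fm.holds_ex (φ : Fm) : φ.ex.Holds e f ↔ ∃ x, φ.Holds (scons x e) f := by
  simp [Fm.ex]

@[simp] theorem Fm.holds_exS (φ : Fm) : φ.exS.Holds e f ↔ ∃ X, φ.Holds e (scons X f) := by
  simp [Fm.exS]

theorem Fm.holds_subst (φ : Fm) (s : ℕ → Tm) (g : ℕ → ℕ) :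
    (φ.subst s g).Holds e f ↔ φ.Holds (fun i => (s i).val e) fun i => f (g i) := by
  induction φ generalizing e f s g with
  | eq t u | lt t u | mem t u | cls t => simp only [Fm.subst, Fm.Holds, Tm.val_subst]
  | bot => rfl
  | imp φ ψ hφ hψ => simp only [Fm.subst, Fm.Holds, hφ, hψ]
  | all φ ih =>
    simp only [Fm.subst_all, Fm.Holds, ih]
    refine forall_congr' fun x => ?_
    rw [show (fun i => (liftTm s i).val (scons x e)) = scons x fun i => (s i).val e from
      funext fun i => by
        cases i
        · rfl
        · exact Tm.val_up _ _ _]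
  | allS φ ih =>
    simp only [Fm.subst_allS, Fm.Holds, ih]
    refine forall_congr' fun X => ?_
    rw [show (fun i => scons X f (liftSet g i)) = scons X fun i => f (g i) from
      funext fun i => by cases i <;> rfl]

@[simp] theorem Fm.holds_at (φ : Fm) (k s : ℕ) (t : Tm) :
    (φ.at k s t).Holds e f ↔ φ.Holds (scons (t.val e) fun i => e (i + k)) fun i => f (i + s) := by
  rw [Fm.at, Fm.holds_subst,
    show (fun i => (scons t (fun i => ♯(i + k)) i).val e) = scons (t.val e) fun i => e (i + k)
      from funext fun i => by cases i <;> rfl]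

end Evaluation

theorem IsBounded.subst {φ : Fm} (h : IsBounded φ) (s : ℕ → Tm) (g : ℕ → ℕ) :
    IsBounded (φ.subst s g) := by
  induction h generalizing s g with
  | eq t u => exact .eq _ _
  | lt t u => exact .lt _ _
  | mem t X => exact .mem _ _
  | bot => exact .bot
  | imp _ _ ih ih' => exact .imp (ih s g) (ih' s g)
  | ball t _ ih =>
    have hbound : (t.up 1).subst (liftTm s) = (t.subst s).up 1 := by
      simp only [Tm.up, Tm.subst_subst]; rfl
    rw [Fm.subst_all, Fm.subst, Fm.subst, hbound]
    exact .ball _ (ih _ _)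

/-! ## Definability -/

/-- `a` and `b` interleaved.  In the formulas that define a predicate with parameters, the arguments
of the predicate are the variables with even numbers, and the parameters are those with odd
numbers. -/
def mix {α : Type} (a b : ℕ → α) (i : ℕ) : α := if i % 2 = 0 then a (i / 2) else b (i / 2)

theorem mix_even {α : Type} (a b : ℕ → α) (i : ℕ) : mix a b (2 * i) = a i := by simp [mix]

theorem mix_odd {α : Type} (a b : ℕ → α) (i : ℕ) : mix a b (2 * i + 1) = b i := by
  simp [mix, Nat.add_mod, show (2 * i + 1) / 2 = i by omega]

theorem eq_mix {α : Type} {a b c : ℕ → α} (ha : ∀ i, c (2 * i) = a i)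
    (hb : ∀ i, c (2 * i + 1) = b i) : c = mix a b := by
  funext i
  obtain ⟨j, rfl | rfl⟩ := i.even_or_odd'
  · rw [ha, mix_even]
  · rw [hb, mix_odd]

/-- The function `g` is given by a term with parameters. -/
class TermFun {N : Str} (g : (ℕ → N.Dom) → N.Dom) : Prop where
  out : ∃ (t : Tm) (p : ℕ → N.Dom), ∀ e, g e = t.val (mix e p)

/-- The predicate `P` is given by a bounded formula with parameters. -/
class Delta0 {N : Str} (P : (ℕ → N.Dom) → Prop) : Prop where
  out : ∃ (θ : Fm) (p : ℕ → N.Dom) (f : ℕ → N.Sets), IsBounded θ ∧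
    ∀ e, P e ↔ θ.Holds (mix e p) f

/-- The predicate `P` is given by a `Σ⁰₁` formula with parameters. -/
class Sigma1 {N : Str} (P : (ℕ → N.Dom) → Prop) : Prop where
  out : ∃ Q : (ℕ → N.Dom) → Prop, Delta0 Q ∧ ∀ e, P e ↔ ∃ x, Q (scons x e)

section Definability

variable {N : Str}

instance TermFun.const (a : N.Dom) : TermFun fun _ : ℕ → N.Dom => a :=
  ⟨♯1, fun _ => a, fun _ => rfl⟩

instance TermFun.var (i : ℕ) : TermFun fun e : ℕ → N.Dom => e i :=
  ⟨♯(2 * i), fun _ => 0, fun _ => (mix_even _ _ _).symm⟩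

theorem TermFun.scons {g : (ℕ → N.Dom) → N.Dom} {G : (ℕ → N.Dom) → ℕ → N.Dom} [h : TermFun g]
    (h' : ∀ i, TermFun fun e => G e i) : ∀ i, TermFun fun e => SOA.scons (g e) (G e) i
  | 0 => h
  | i + 1 => h' i

-- The parameters of the terms for the `G · i` are merged into one sequence by `Nat.pair`.
theorem TermFun.exists_subst {G : (ℕ → N.Dom) → ℕ → N.Dom} (hG : ∀ i, TermFun fun e => G e i)
    (p : ℕ → N.Dom) : ∃ (s : ℕ → Tm) (q : ℕ → N.Dom), ∀ e,
      (fun i => (s i).val (mix e q)) = mix (G e) p := by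
  choose t q ht using fun i => (hG i).out
  refine ⟨mix (fun i => (t i).subst <| mix (fun j => ♯(2 * j))
      fun j => ♯(2 * (2 * Nat.pair i j + 1) + 1)) (fun i => ♯(2 * (2 * i) + 1)),
    mix p fun n => q n.unpair.1 n.unpair.2, fun e => eq_mix (fun i => ?_) fun i => ?_⟩
  · rw [mix_even, Tm.val_subst, ht]
    congr 1
    refine eq_mix (fun j => ?_) fun j => ?_
    · rw [mix_even, Tm.val_var, mix_even]
    · rw [mix_odd, Tm.val_var, mix_odd, mix_odd, Nat.unpair_pair]
  · rw [mix_odd, Tm.val_var, mix_odd, mix_even]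

theorem TermFun.comp {g : (ℕ → N.Dom) → N.Dom} {G : (ℕ → N.Dom) → ℕ → N.Dom} (hg : TermFun g)
    (hG : ∀ i, TermFun fun e => G e i) : TermFun fun e => g (G e) := by
  obtain ⟨t, p, ht⟩ := hg
  obtain ⟨s, q, hs⟩ := exists_subst hG p
  exact ⟨t.subst s, q, fun e => by rw [ht, Tm.val_subst, hs]⟩

theorem Delta0.comp {P : (ℕ → N.Dom) → Prop} {G : (ℕ → N.Dom) → ℕ → N.Dom} (h : Delta0 P)
    (hG : ∀ i, TermFun fun e => G e i) : Delta0 fun e => P (G e) := by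
  obtain ⟨θ, p, f, hθ, h⟩ := h
  obtain ⟨s, q, hs⟩ := TermFun.exists_subst hG p
  exact ⟨θ.subst s id, q, f, hθ.subst _ _, fun e => by rw [h, Fm.holds_subst, hs]; rfl⟩

theorem TermFun.of_val (t : Tm) : TermFun fun e : ℕ → N.Dom => t.val e :=
  ⟨t.subst fun i => ♯(2 * i), fun _ => 0, fun e => by
    simp only [Tm.val_subst, Tm.val_var, mix_even]⟩

theorem Delta0.of_holds {θ : Fm} (hθ : IsBounded θ) (f : ℕ → N.Sets) :
    Delta0 fun e => θ.Holds e f :=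
  ⟨θ.subst (fun i => ♯(2 * i)) id, fun _ => 0, f, hθ.subst _ _, fun e => by
    simp only [Fm.holds_subst, Tm.val_var, mix_even, id_eq]⟩

variable {P P' : (ℕ → N.Dom) → Prop} {g g' : (ℕ → N.Dom) → N.Dom}

theorem Delta0.congr (h : Delta0 P) (hP : ∀ e, P' e ↔ P e) : Delta0 P' := by
  rwa [show P' = P from funext fun e => propext (hP e)]

theorem Sigma1.congr (h : Sigma1 P) (hP : ∀ e, P' e ↔ P e) : Sigma1 P' := by
  rwa [show P' = P from funext fun e => propext (hP e)]

theorem Delta0.exists_common (h : Delta0 P) (h' : Delta0 P') :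
    ∃ (θ θ' : Fm) (p : ℕ → N.Dom) (f : ℕ → N.Sets), IsBounded θ ∧ IsBounded θ' ∧
      (∀ e, P e ↔ θ.Holds (mix e p) f) ∧ ∀ e, P' e ↔ θ'.Holds (mix e p) f := by
  obtain ⟨θ, p, f, hθ, h⟩ := h
  obtain ⟨θ', p', f', hθ', h'⟩ := h'
  refine ⟨θ.subst (mix (fun i => ♯(2 * i)) fun i => ♯(2 * (2 * i) + 1)) fun i => 2 * i,
    θ'.subst (mix (fun i => ♯(2 * i)) fun i => ♯(2 * (2 * i + 1) + 1)) fun i => 2 * i + 1,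
    mix p p', mix f f', hθ.subst _ _, hθ'.subst _ _, fun e => ?_, fun e => ?_⟩
  · rw [h, Fm.holds_subst]
    congr! 1
    · exact (eq_mix (fun i => by simp only [mix_even, Tm.val_var])
        fun i => by simp only [mix_odd, mix_even, Tm.val_var]).symm
    · exact funext fun i => (mix_even f f' i).symm
  · rw [h', Fm.holds_subst]
    congr! 1
    · exact (eq_mix (fun i => by simp only [mix_even, Tm.val_var])
        fun i => by simp only [mix_odd, Tm.val_var]).symm
    · exact funext fun i => (mix_odd f f' i).symm

instance TermFun.add [TermFun g] [h' : TermFun g'] : TermFun fun e => g e + g' e :=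
  (of_val (♯0 + ♯1)).comp (TermFun.scons (g := g) fun _ => h')

instance TermFun.mul [TermFun g] [h' : TermFun g'] : TermFun fun e => g e * g' e :=
  (of_val (♯0 * ♯1)).comp (TermFun.scons (g := g) fun _ => h')

theorem Delta0.comp₂ {R : N.Dom → N.Dom → Prop} (h : Delta0 fun e => R (e 0) (e 1)) [TermFun g]
    [h' : TermFun g'] : Delta0 fun e => R (g e) (g' e) :=
  h.comp (TermFun.scons (g := g) fun _ => h')

theorem Delta0.of_formula {R : N.Dom → N.Dom → Prop} {θ : Fm} (hθ : IsBounded θ)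
    (f : ℕ → N.Sets) (h : ∀ e, θ.Holds e f ↔ R (e 0) (e 1)) [TermFun g] [TermFun g'] :
    Delta0 fun e => R (g e) (g' e) :=
  ((of_holds hθ f).congr fun e => (h e).symm).comp₂

noncomputable instance : Inhabited N.Sets := Classical.inhabited_of_nonempty N.nonempty

instance Delta0.eq [TermFun g] [TermFun g'] : Delta0 fun e => g e = g' e :=
  of_formula (.eq ♯0 ♯1) default fun _ => Iff.rfl

instance Delta0.lt [TermFun g] [TermFun g'] : Delta0 fun e => g e < g' e :=
  of_formula (.lt ♯0 ♯1) default fun _ => Iff.rfl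

instance Delta0.mem [h : TermFun g] (X : N.Sets) : Delta0 fun e => g e ∈ X :=
  (of_holds (.mem ♯0 0) fun _ => X).comp fun _ => h

instance Delta0.false : Delta0 fun _ : ℕ → N.Dom => False :=
  of_holds .bot default

instance Delta0.imp [h : Delta0 P] [h' : Delta0 P'] : Delta0 fun e => P e → P' e := by
  obtain ⟨θ, θ', p, f, hθ, hθ', h, h'⟩ := h.exists_common h'
  exact ⟨θ ➔ θ', p, f, hθ.imp hθ', fun e => by rw [h, h', Fm.holds_imp]⟩

instance Delta0.not [Delta0 P] : Delta0 fun e => ¬ P e :=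
  (inferInstance : Delta0 fun e => P e → False)

instance Delta0.and [Delta0 P] [Delta0 P'] : Delta0 fun e => P e ∧ P' e :=
  (inferInstance : Delta0 fun e => ¬ (P e → ¬ P' e)).congr fun e => by tauto

instance Delta0.or [Delta0 P] [Delta0 P'] : Delta0 fun e => P e ∨ P' e :=
  (inferInstance : Delta0 fun e => ¬ P e → P' e).congr fun e => by tauto

theorem Delta0.ball_var {P : N.Dom → (ℕ → N.Dom) → Prop}
    (h : Delta0 fun e => P (e 0) fun i => e (i + 1)) :
    Delta0 fun e => ∀ x, x < e 0 → P x fun i => e (i + 1) := by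
  obtain ⟨θ, p, f, hθ, h⟩ := h
  let r := mix (scons 0 fun i => 2 * (i + 1) + 1) fun i => 2 * i + 2
  refine ⟨(♯0 ≺ (♯0 : Tm).up 1 ➔ θ.subst (fun i => ♯(r i)) id).all, p, f,
    .ball _ (hθ.subst _ _), fun e => forall_congr' fun x => imp_congr_right fun _ => ?_⟩
  refine (h (scons x fun i => e (i + 1))).trans ?_
  rw [Fm.holds_subst]
  congr! 1
  refine (eq_mix (fun i => ?_) fun i => ?_).symm
  · rcases i with _ | i
    · rfl
    · simp only [r, mix_even, Tm.val_var, scons_succ]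
  · simp only [r, mix_odd, Tm.val_var, scons_succ]

instance Delta0.ball {P : N.Dom → (ℕ → N.Dom) → Prop} [TermFun g]
    [h : Delta0 fun e => P (e 0) fun i => e (i + 1)] : Delta0 fun e => ∀ x, x < g e → P x e :=
  (ball_var h).comp (TermFun.scons (g := g) fun i => TermFun.var i)

instance Delta0.bex {P : N.Dom → (ℕ → N.Dom) → Prop} [TermFun g]
    [Delta0 fun e => P (e 0) fun i => e (i + 1)] : Delta0 fun e => ∃ x, x < g e ∧ P x e :=
  (inferInstance : Delta0 fun e => ¬ ∀ x, x < g e → ¬ P x e).congr fun e => by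
    simp only [not_forall, not_not, exists_prop]

instance Sigma1.ex_of_delta0 {P : N.Dom → (ℕ → N.Dom) → Prop}
    [h : Delta0 fun e => P (e 0) fun i => e (i + 1)] : Sigma1 fun e => ∃ x, P x e :=
  ⟨_, h, fun _ => Iff.rfl⟩

instance Sigma1.of_delta0 [h : Delta0 P] : Sigma1 P :=
  ⟨_, h.comp fun i => TermFun.var (i + 1), fun e => ⟨fun h => ⟨e 0, h⟩, fun ⟨_, h⟩ => h⟩⟩

theorem Sigma1.exists_formulas {P P' : N.Dom → Prop} (h : Sigma1 fun e => P (e 0))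
    (h' : Sigma1 fun e => P' (e 0)) :
    ∃ (θ θ' : Fm) (p : ℕ → N.Dom) (f : ℕ → N.Sets), IsBounded θ ∧ IsBounded θ' ∧
      (∀ x, P x ↔ θ.ex.Holds (scons x p) f) ∧ ∀ x, P' x ↔ θ'.ex.Holds (scons x p) f := by
  obtain ⟨Q, hQ, h⟩ := h
  obtain ⟨Q', hQ', h'⟩ := h'
  obtain ⟨θ, θ', p, f, hθ, hθ', hQ, hQ'⟩ := hQ.exists_common hQ'
  let r := mix (scons 0 fun _ => 1) fun i => i + 2
  have hr : ∀ w x, (fun i => (♯(r i)).val (scons w (scons x p))) = mix (scons w fun _ => x) p :=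
    fun w x => eq_mix (fun i => by cases i <;> simp only [r, mix_even] <;> rfl)
      fun i => by simp only [r, mix_odd]; rfl
  refine ⟨θ.subst (fun i => ♯(r i)) id, θ'.subst (fun i => ♯(r i)) id, p, f, hθ.subst _ _,
    hθ'.subst _ _, fun x => ?_, fun x => ?_⟩
  · simp only [Fm.holds_ex, Fm.holds_subst, hr, id_eq, ← hQ]
    exact h fun _ => x
  · simp only [Fm.holds_ex, Fm.holds_subst, hr, id_eq, ← hQ']
    exact h' fun _ => x

end Definability

/-! ## Induction and comprehension -/

/-- `N` is a model of `RCA0`. -/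
class Str.IsRCA (N : Str) : Prop where
  models : N.Models RCA0

section Models

variable {N : Str} [hN : N.IsRCA]

theorem sigma_induction {P : N.Dom → Prop} [h : Sigma1 fun e => P (e 0)] (zero : P 0)
    (succ : ∀ x, P x → P (x + 1)) (x : N.Dom) : P x := by
  obtain ⟨θ, -, p, f, hθ, -, hP, -⟩ := h.exists_formulas h
  have hind := hN.models _ (.induction θ.ex ⟨θ, hθ, rfl⟩) p f
  simp only [Fm.holds_imp, Fm.holds_all, Fm.inst, Fm.holds_subst, id_eq, ← hP] at hind
  have hinst : (fun i => (scons (0 : Tm) Tm.var i).val p) = scons 0 p :=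
    funext fun i => by cases i <;> rfl
  have hsucc : ∀ y, (fun i => (scons (♯0 + 1 : Tm) (fun i => ♯(i + 1)) i).val (scons y p)) =
      scons (y + 1) p := fun y => funext fun i => by cases i <;> rfl
  simp only [hinst, hsucc, ← hP] at hind
  exact hind zero succ x

theorem delta_comprehension {P : N.Dom → Prop} [h : Sigma1 fun e => P (e 0)]
    [h' : Sigma1 fun e => ¬ P (e 0)] : ∃ X : N.Sets, ∀ x, x ∈ X ↔ P x := by
  obtain ⟨θ, θ', p, f, hθ, hθ', hP, hP'⟩ := h.exists_formulas (P' := fun x => ¬ P x) h'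
  have hpi : ∀ x, θ'.neg.all.Holds (scons x p) f ↔ P x := fun x => by
    rw [← not_not (a := P x), hP', Fm.holds_ex, not_exists]
    rfl
  have hcomp := hN.models _ (.comprehension θ.ex θ'.neg.all ⟨θ, hθ, rfl⟩
    ⟨θ'.neg, hθ'.imp .bot, rfl⟩) p f
  simp only [Fm.holds_imp, Fm.holds_all _ _ (_ ⟺ _), Fm.holds_iff, Fm.holds_exS, Fm.wkS,
    Fm.holds_subst, Fm.holds_mem, Tm.val_var, scons_zero, scons_succ, hpi, ← hP] at hcomp
  exact hcomp fun _ => trivial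

end Models

/-! ## Arithmetic in a model -/

namespace Str

variable {N : Str} [hN : N.IsRCA]

theorem exists_holds {φ : Fm} (h : φ ∈ RCA0) (e : ℕ → N.Dom) : ∃ f : ℕ → N.Sets, φ.Holds e f :=
  N.nonempty.elim fun X => ⟨fun _ => X, hN.models φ h e _⟩

theorem succ_ne_zero (x : N.Dom) : x + 1 ≠ 0 :=
  (exists_holds .succ_ne_zero fun _ => x).elim fun _ h => h

theorem succ_inj {x y : N.Dom} (h : x + 1 = y + 1) : x = y :=
  (exists_holds .succ_inj (scons x fun _ => y)).elim fun _ h' => h' h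

theorem add_zero (x : N.Dom) : x + 0 = x :=
  (exists_holds .add_zero fun _ => x).elim fun _ h => h

theorem add_succ (x y : N.Dom) : x + (y + 1) = (x + y) + 1 :=
  (exists_holds .add_succ (scons x fun _ => y)).elim fun _ h => h

theorem mul_zero (x : N.Dom) : x * 0 = 0 :=
  (exists_holds .mul_zero fun _ => x).elim fun _ h => h

theorem mul_succ (x y : N.Dom) : x * (y + 1) = x * y + x :=
  (exists_holds .mul_succ (scons x fun _ => y)).elim fun _ h => h

theorem not_lt_zero (x : N.Dom) : ¬ x < 0 :=
  (exists_holds .not_lt_zero fun _ => x).elim fun _ h => h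

theorem lt_succ {x y : N.Dom} : x < y + 1 ↔ x < y ∨ x = y :=
  (exists_holds .lt_succ (scons x fun _ => y)).elim fun f h => by
    simpa only [Fm.holds_iff, Fm.holds_or] using! h

theorem delta_induction {P : N.Dom → Prop} [Delta0 fun e => P (e 0)] (zero : P 0)
    (succ : ∀ x, P x → P (x + 1)) (x : N.Dom) : P x :=
  sigma_induction zero succ x

theorem zero_add (x : N.Dom) : 0 + x = x :=
  delta_induction (P := fun x => 0 + x = x) (add_zero 0) (fun x h => by rw [add_succ, h]) x

theorem succ_add (x y : N.Dom) : (x + 1) + y = (x + y) + 1 :=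
  delta_induction (P := fun y => (x + 1) + y = (x + y) + 1) (by rw [add_zero, add_zero])
    (fun y h => by rw [add_succ, h, add_succ]) y

theorem add_comm (x y : N.Dom) : x + y = y + x :=
  delta_induction (P := fun y => x + y = y + x) (by rw [add_zero, zero_add])
    (fun y h => by rw [add_succ, h, succ_add]) y

theorem add_assoc (x y z : N.Dom) : x + y + z = x + (y + z) :=
  delta_induction (P := fun z => x + y + z = x + (y + z)) (by rw [add_zero, add_zero])
    (fun z h => by rw [add_succ, h, add_succ, add_succ]) z

theorem zero_mul (x : N.Dom) : 0 * x = 0 :=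
  delta_induction (P := fun x => 0 * x = 0) (mul_zero 0)
    (fun x h => by rw [mul_succ, h, add_zero]) x

theorem succ_mul (x y : N.Dom) : (x + 1) * y = x * y + y :=
  delta_induction (P := fun y => (x + 1) * y = x * y + y) (by rw [mul_zero, mul_zero, add_zero])
    (fun y h => by
      rw [mul_succ, h, mul_succ, ← add_assoc, ← add_assoc, add_assoc (x * y) y x, add_comm y x,
        ← add_assoc]) y

theorem mul_comm (x y : N.Dom) : x * y = y * x :=
  delta_induction (P := fun y => x * y = y * x) (by rw [mul_zero, zero_mul])
    (fun y h => by rw [mul_succ, h, succ_mul]) y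

theorem mul_add (x y z : N.Dom) : x * (y + z) = x * y + x * z :=
  delta_induction (P := fun z => x * (y + z) = x * y + x * z)
    (by rw [mul_zero, add_zero, add_zero])
    (fun z h => by rw [add_succ, mul_succ, h, mul_succ, add_assoc]) z

theorem mul_assoc (x y z : N.Dom) : x * y * z = x * (y * z) :=
  delta_induction (P := fun z => x * y * z = x * (y * z)) (by simp only [mul_zero])
    (fun z h => by rw [mul_succ, h, mul_succ, mul_add]) z

theorem mul_one (x : N.Dom) : x * 1 = x := by
  rw [← zero_add (1 : N.Dom), mul_succ, mul_zero, zero_add]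

theorem add_right_cancel (x y z : N.Dom) : x + z = y + z → x = y :=
  delta_induction (P := fun z => x + z = y + z → x = y) (by simp only [add_zero, imp_self])
    (fun z h h' => h (succ_inj (by rwa [add_succ, add_succ] at h'))) z

instance : CommSemiring N.Dom where
  add_assoc := add_assoc
  zero_add := zero_add
  add_zero := add_zero
  add_comm := add_comm
  left_distrib := mul_add
  right_distrib x y z := by rw [mul_comm, mul_add, mul_comm z x, mul_comm z y]
  zero_mul := zero_mul
  mul_zero := mul_zero
  mul_assoc := mul_assoc
  one_mul x := by rw [mul_comm, mul_one]
  mul_one := mul_one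
  mul_comm := mul_comm
  nsmul := nsmulRec

theorem zero_lt_succ (x : N.Dom) : 0 < x + 1 :=
  delta_induction (P := fun x => 0 < x + 1) (lt_succ.2 (.inr rfl))
    (fun _ h => lt_succ.2 (.inl h)) x

theorem eq_zero_or_succ (x : N.Dom) : x = 0 ∨ ∃ y, x = y + 1 := by
  obtain ⟨y, hy⟩ := sigma_induction (P := fun x => ∃ y, x ≠ 0 → x = y + 1) ⟨0, by simp⟩
    (fun x _ => ⟨x, fun _ => rfl⟩) x
  by_cases h : x = 0
  · exact .inl h
  · exact .inr ⟨y, hy h⟩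

theorem lt_add_succ (x z : N.Dom) : x < x + z + 1 :=
  delta_induction (P := fun z => x < x + z + 1) (lt_succ.2 (.inr (by simp)))
    (fun z h => lt_succ.2 (.inl (by rwa [← add_assoc]))) z

theorem lt_iff_exists {x y : N.Dom} : x < y ↔ ∃ z, y = x + z + 1 := by
  constructor
  · intro h
    have hdiff : ∃ z, x < y → y = x + z + 1 := by
      refine sigma_induction (P := fun y => ∃ z, x < y → y = x + z + 1)
        ⟨0, fun h => (not_lt_zero _ h).elim⟩ ?_ y
      rintro y ⟨z, hz⟩
      by_cases h : x < y
      · exact ⟨z + 1, fun _ => by rw [hz h]; ring⟩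
      · refine ⟨0, fun h' => ?_⟩
        rcases lt_succ.1 h' with h' | rfl
        · exact (h h').elim
        · simp
    exact hdiff.imp fun z hz => hz h
  · rintro ⟨z, rfl⟩
    exact lt_add_succ x z

theorem trichotomy (x y : N.Dom) : x < y ∨ x = y ∨ y < x := by
  refine delta_induction (P := fun y => x < y ∨ x = y ∨ y < x) ?_ ?_ y
  · rcases eq_zero_or_succ x with rfl | ⟨z, rfl⟩
    · simp
    · exact .inr (.inr (zero_lt_succ z))
  · rintro y (h | rfl | h)
    · exact .inl (lt_succ.2 (.inl h))
    · exact .inl (lt_succ.2 (.inr rfl))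
    · obtain ⟨z, rfl⟩ := lt_iff_exists.1 h
      rcases eq_zero_or_succ z with rfl | ⟨w, rfl⟩
      · simp
      · exact .inr (.inr (lt_iff_exists.2 ⟨w, by ring⟩))

theorem lt_irrefl (x : N.Dom) : ¬ x < x := by
  intro h
  obtain ⟨z, hz⟩ := lt_iff_exists.1 h
  refine succ_ne_zero z (add_right_cancel _ _ x ?_)
  rw [zero_add]
  conv_rhs => rw [hz]
  ring

theorem lt_trans {x y z : N.Dom} (h : x < y) (h' : y < z) : x < z := by
  obtain ⟨a, rfl⟩ := lt_iff_exists.1 h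
  obtain ⟨b, rfl⟩ := lt_iff_exists.1 h'
  exact lt_iff_exists.2 ⟨a + b + 1, by ring⟩

noncomputable instance : LinearOrder N.Dom where
  le x y := x < y ∨ x = y
  lt := (· < ·)
  le_refl x := .inr rfl
  le_trans := by
    rintro x y z (h | rfl) (h' | rfl)
    · exact .inl (lt_trans h h')
    · exact .inl h
    · exact .inl h'
    · exact .inr rfl
  lt_iff_le_not_ge x y := by
    constructor
    · intro h
      refine ⟨.inl h, ?_⟩
      rintro (h' | rfl)
      · exact lt_irrefl _ (lt_trans h h')
      · exact lt_irrefl _ h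
    · rintro ⟨h | rfl, h'⟩
      · exact h
      · exact (h' (.inr rfl)).elim
  le_antisymm := by
    rintro x y (h | rfl) (h' | h')
    · exact (lt_irrefl _ (lt_trans h h')).elim
    · exact h'.symm
    · rfl
    · rfl
  le_total x y := by
    rcases trichotomy x y with h | h | h
    · exact .inl (.inl h)
    · exact .inl (.inr h)
    · exact .inr (.inl h)
  toDecidableLE := Classical.decRel _

theorem le_iff_exists {x y : N.Dom} : x ≤ y ↔ ∃ z, y = x + z := by
  constructor
  · rintro (h | rfl)
    · obtain ⟨z, rfl⟩ := lt_iff_exists.1 h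
      exact ⟨z + 1, by ring⟩
    · exact ⟨0, by simp⟩
  · rintro ⟨z, rfl⟩
    rcases eq_zero_or_succ z with rfl | ⟨w, rfl⟩
    · exact .inr (by simp)
    · exact .inl (lt_iff_exists.2 ⟨w, by ring⟩)

instance : IsStrictOrderedRing N.Dom where
  add_le_add_left x y h z := by
    obtain ⟨w, rfl⟩ := le_iff_exists.1 h
    exact le_iff_exists.2 ⟨w, by ring⟩
  le_of_add_le_add_left x y z h := by
    obtain ⟨w, hw⟩ := le_iff_exists.1 h
    exact le_iff_exists.2 ⟨w, add_right_cancel _ _ x (by rw [add_comm z x, hw]; ring)⟩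
  zero_le_one := le_iff_exists.2 ⟨1, by simp⟩
  exists_pair_ne := ⟨0, 1, fun h => succ_ne_zero (0 : N.Dom) (by rw [zero_add, ← h])⟩
  mul_lt_mul_of_pos_left x hx y z h := by
    obtain ⟨a, rfl⟩ := lt_iff_exists.1 hx
    obtain ⟨b, rfl⟩ := lt_iff_exists.1 h
    exact lt_iff_exists.2 ⟨a * b + b + a, by ring⟩
  mul_lt_mul_of_pos_right x hx y z h := by
    obtain ⟨a, rfl⟩ := lt_iff_exists.1 hx
    obtain ⟨b, rfl⟩ := lt_iff_exists.1 h
    exact lt_iff_exists.2 ⟨a * b + b + a, by ring⟩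

instance : CanonicallyOrderedAdd N.Dom where
  exists_add_of_le h := le_iff_exists.1 h
  le_add_self _ y := le_iff_exists.2 ⟨y, add_comm _ _⟩
  le_self_add _ y := le_iff_exists.2 ⟨y, rfl⟩

theorem lt_succ_iff {x y : N.Dom} : x < y + 1 ↔ x ≤ y := lt_succ

noncomputable instance : SuccOrder N.Dom := SuccOrder.ofSuccLeIff (· + 1) fun {a b} => by
  rw [← lt_succ_iff, add_lt_add_iff_right]

noncomputable instance : SuccAddOrder N.Dom := ⟨fun _ => rfl⟩
end Str

/-! ## `Σ⁰₁` definability in a model -/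

section Sigma

variable {N : Str} [hN : N.IsRCA] {g g' : (ℕ → N.Dom) → N.Dom} {P P' : (ℕ → N.Dom) → Prop}

instance Delta0.le [TermFun g] [TermFun g'] : Delta0 fun e => g e ≤ g' e :=
  (inferInstance : Delta0 fun e => g e < g' e ∨ g e = g' e).congr fun _ => le_iff_lt_or_eq

-- A pair of witnesses is bounded by a single witness.
instance Sigma1.ex {P : N.Dom → (ℕ → N.Dom) → Prop}
    [h : Sigma1 fun e => P (e 0) fun i => e (i + 1)] : Sigma1 fun e => ∃ x, P x e := by
  obtain ⟨Q, hQ, h⟩ := h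
  have hQ' : Delta0 fun e => Q (scons (e 0) (scons (e 1) fun i => e (i + 3))) :=
    hQ.comp (TermFun.scons (TermFun.scons fun i => .var (i + 3)))
  refine (inferInstance : Sigma1 fun e => ∃ z, ∃ x, x < z ∧ ∃ w, w < z ∧
    Q (scons w (scons x e))).congr fun e => ?_
  constructor
  · rintro ⟨x, hx⟩
    obtain ⟨w, hw⟩ := (h (scons x e)).1 hx
    exact ⟨max x w + 1, x, by simp, w, by simp, hw⟩
  · rintro ⟨_, x, -, w, -, hw⟩
    exact ⟨x, (h (scons x e)).2 ⟨w, hw⟩⟩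

instance Sigma1.and [h : Sigma1 P] [h' : Sigma1 P'] : Sigma1 fun e => P e ∧ P' e := by
  obtain ⟨Q, hQ, h⟩ := h
  obtain ⟨Q', hQ', h'⟩ := h'
  have hx : Delta0 fun e => Q (scons (e 1) fun i => e (i + 2)) :=
    hQ.comp (TermFun.scons fun i => .var (i + 2))
  have hy : Delta0 fun e => Q' (scons (e 0) fun i => e (i + 2)) :=
    hQ'.comp (TermFun.scons fun i => .var (i + 2))
  refine (inferInstance : Sigma1 fun e => ∃ x, ∃ y, Q (scons x e) ∧ Q' (scons y e)).congr
    fun e => ?_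
  rw [h, h', exists_and_exists_comm]

instance Sigma1.imp [h : Delta0 P] [h' : Sigma1 P'] : Sigma1 fun e => P e → P' e := by
  obtain ⟨Q, hQ, h'⟩ := h'
  have hP : Delta0 fun e => P fun i => e (i + 1) := h.comp fun i => .var (i + 1)
  refine ⟨fun e => P (fun i => e (i + 1)) → Q e, inferInstance, fun e => ?_⟩
  simp only [h', scons_succ, imp_iff_not_or, exists_or, exists_const]

theorem delta_collection {R : N.Dom → N.Dom → Prop} [Delta0 fun e => R (e 0) (e 1)] (b : N.Dom)
    (h : ∀ x, x < b → ∃ w, R w x) : ∃ B, ∀ x, x < b → ∃ w, w < B ∧ R w x := by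
  obtain ⟨B, hB⟩ : ∃ B, ∀ x, x < b → x < b → ∃ w, w < B ∧ R w x := by
    refine sigma_induction (P := fun j => ∃ B, ∀ x, x < j → x < b → ∃ w, w < B ∧ R w x)
      ⟨0, fun x hx => (not_lt_zero hx).elim⟩ ?_ b
    rintro j ⟨B, hB⟩
    by_cases hj : j < b
    · obtain ⟨w, hw⟩ := h j hj
      refine ⟨max B (w + 1), fun x hx hxb => ?_⟩
      rcases (Str.lt_succ_iff.1 hx).lt_or_eq with hx | rfl
      · obtain ⟨v, hv, hR⟩ := hB x hx hxb
        exact ⟨v, lt_max_of_lt_left hv, hR⟩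
      · exact ⟨w, lt_max_of_lt_right (lt_add_one w), hw⟩
    · exact ⟨B, fun x _ hxb => hB x (hxb.trans_le (not_lt.1 hj)) hxb⟩
  exact ⟨B, fun x hx => hB x hx hx⟩

instance Sigma1.ball {P : N.Dom → (ℕ → N.Dom) → Prop} [TermFun g]
    [h : Sigma1 fun e => P (e 0) fun i => e (i + 1)] : Sigma1 fun e => ∀ x, x < g e → P x e := by
  obtain ⟨Q, hQ, h⟩ := h
  have hQ' : Delta0 fun e => Q (scons (e 0) (scons (e 1) fun i => e (i + 3))) :=
    hQ.comp (TermFun.scons (TermFun.scons fun i => .var (i + 3)))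
  have hg : TermFun fun e => g fun i => e (i + 1) :=
    TermFun.comp inferInstance fun i => .var (i + 1)
  refine (inferInstance : Sigma1 fun e => ∃ B, ∀ x, x < g e → ∃ w, w < B ∧
    Q (scons w (scons x e))).congr fun e => ?_
  have hP : ∀ x, P x e ↔ ∃ w, Q (scons w (scons x e)) := fun x => h (scons x e)
  simp only [hP]
  constructor
  · intro hx
    have hQe : Delta0 fun e' => Q (scons (e' 0) (scons (e' 1) e)) :=
      hQ.comp (TermFun.scons (TermFun.scons fun i => .const (e i)))
    exact delta_collection _ hx
  · rintro ⟨B, hB⟩ x hx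
    exact (hB x hx).imp fun _ => And.right

theorem sigma_exists_last {P : N.Dom → Prop} [Sigma1 fun e => P (e 0)] (h0 : P 0) {b : N.Dom}
    (hb : ∀ x, P x → x ≤ b) : ∃ x, P x ∧ ¬ P (x + 1) := by
  by_contra! h
  exact absurd (hb _ (sigma_induction h0 h (b + 1))) (not_le.2 (lt_add_one b))

theorem delta_existsUnique_least {P : N.Dom → Prop} [Delta0 fun e => P (e 0)] {a : N.Dom}
    (ha : P a) : ∃! x, P x ∧ ∀ y, y < x → ¬ P y := by
  obtain ⟨x, hx, hmin⟩ : ∃ x, P x ∧ ∀ y, y < x → ¬ P y := by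
    by_contra! h
    have hbelow : ∀ y, y < a + 1 → ¬ P y := by
      refine Str.delta_induction (P := fun x => ∀ y, y < x → ¬ P y)
        (fun y hy => (not_lt_zero hy).elim) ?_ (a + 1)
      intro x hx y hy hP
      rcases (Str.lt_succ_iff.1 hy).lt_or_eq with hy | rfl
      · exact hx y hy hP
      · obtain ⟨z, hz, hPz⟩ := h y hP
        exact hx z hz hPz
    exact hbelow a (lt_add_one a) ha
  refine ⟨x, ⟨hx, hmin⟩, fun y ⟨hy, hymin⟩ => ?_⟩
  exact le_antisymm (not_lt.1 fun h => hymin x h hx) (not_lt.1 fun h => hmin y h hy)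

end Sigma

/-! ## Bounded formulas -/

/-- The bounded existential quantification `∃ x < t, φ`. -/
def bexF (t : Tm) (φ : Fm) : Fm := (♯0 ≺ t.up 1 ➔ φ.neg).all.neg

/-- The bounded universal quantification `∀ x < t, φ`. -/
def ballF (t : Tm) (φ : Fm) : Fm := (♯0 ≺ t.up 1 ➔ φ).all

theorem IsBounded.neg {φ : Fm} (h : IsBounded φ) : IsBounded φ.neg := h.imp .bot

theorem IsBounded.and {φ ψ : Fm} (h : IsBounded φ) (h' : IsBounded ψ) : IsBounded (φ ⋏ ψ) :=
  (h.imp h'.neg).neg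

theorem IsBounded.iff {φ ψ : Fm} (h : IsBounded φ) (h' : IsBounded ψ) : IsBounded (φ ⟺ ψ) :=
  (h.imp h').and (h'.imp h)

theorem IsBounded.bexF {φ : Fm} {t : Tm} (h : IsBounded φ) : IsBounded (bexF t φ) :=
  (IsBounded.ball t h.neg).neg

theorem IsBounded.ballF {φ : Fm} {t : Tm} (h : IsBounded φ) : IsBounded (ballF t φ) := .ball t h

section Bounded

variable {N : Str} (e : ℕ → N.Dom) (f : ℕ → N.Sets)

@[simp] theorem holds_bexF (t : Tm) (φ : Fm) :
    (bexF t φ).Holds e f ↔ ∃ x, x < t.val e ∧ φ.Holds (scons x e) f := by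
  simp [bexF]

@[simp] theorem holds_ballF (t : Tm) (φ : Fm) :
    (ballF t φ).Holds e f ↔ ∀ x, x < t.val e → φ.Holds (scons x e) f := by
  simp [ballF]

end Bounded

/-! ## Pairs and divisibility -/

/-- The code of an ordered pair. -/
def pr {N : Str} (x y : N.Dom) : N.Dom := (x + y) * (x + y) + x

@[simp] theorem val_pair {N : Str} (e : ℕ → N.Dom) (t u : Tm) :
    (pair t u).val e = pr (t.val e) (u.val e) := by
  simp [pair, pr]

section Coding

variable {N : Str} [hN : N.IsRCA]

/-- `t` divides `u`, as a bounded formula. -/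
def dvdF (t u : Tm) : Fm := bexF (u + 1) (u.up 1 ≐ t.up 1 * ♯0)

theorem isBounded_dvdF (t u : Tm) : IsBounded (dvdF t u) := .bexF (.eq _ _)

@[simp] theorem holds_dvdF (e : ℕ → N.Dom) (f : ℕ → N.Sets) (t u : Tm) :
    (dvdF t u).Holds e f ↔ t.val e ∣ u.val e := by
  simp only [dvdF, holds_bexF, Tm.val_add, Tm.val_one, Fm.holds_eq, Tm.val_up, scons_succ,
    Tm.val_mul, Tm.val_var, scons_zero]
  refine ⟨fun ⟨q, _, hq⟩ => ⟨q, hq⟩, fun ⟨q, hq⟩ => ?_⟩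
  rcases eq_or_ne (t.val e) 0 with h | h
  · exact ⟨0, by simp, by simp [hq, h]⟩
  · refine ⟨q, Str.lt_succ_iff.2 ?_, hq⟩
    rw [hq]
    exact le_mul_of_one_le_left zero_le (Order.one_le_iff_pos.2 (pos_iff_ne_zero.2 h))

instance Delta0.dvd {g g' : (ℕ → N.Dom) → N.Dom} [TermFun g] [TermFun g'] :
    Delta0 fun e => g e ∣ g' e :=
  .of_formula (isBounded_dvdF ♯0 ♯1) default fun _ => holds_dvdF _ _ _ _

theorem le_of_dvd {a x : N.Dom} (hx : x ≠ 0) (h : a ∣ x) : a ≤ x := by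
  obtain ⟨q, rfl⟩ := h
  exact le_mul_of_one_le_right zero_le
    (Order.one_le_iff_pos.2 (pos_iff_ne_zero.2 (right_ne_zero_of_mul hx)))

theorem dvd_of_dvd_add {a x y : N.Dom} (h : a ∣ x + y) (hx : a ∣ x) : a ∣ y := by
  obtain ⟨p, rfl⟩ := hx
  obtain ⟨q, hq⟩ := h
  rcases le_total p q with hpq | hqp
  · obtain ⟨r, rfl⟩ := exists_add_of_le hpq
    rw [mul_add] at hq
    exact ⟨r, add_left_cancel hq⟩
  · have hy : a * p + y ≤ a * p + 0 := by
      rw [hq, add_zero]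
      exact mul_le_mul_right hqp a
    rw [nonpos_iff_eq_zero.1 (le_of_add_le_add_left hy)]
    exact dvd_zero a

theorem dvd_of_dvd_mul_of_dvd {a n x : N.Dom} (hx : x ∣ a) (h : a + 1 ∣ n * x) : a + 1 ∣ n :=
  dvd_of_dvd_add (x := n * a) ⟨n, by ring⟩ (h.trans (mul_dvd_mul_left n hx))

theorem left_le_pr (x y : N.Dom) : x ≤ pr x y := le_add_self

theorem right_le_pr (x y : N.Dom) : y ≤ pr x y := by
  have le_mul_self : x + y ≤ (x + y) * (x + y) := by
    rcases Str.eq_zero_or_succ (x + y) with h | ⟨z, h⟩ <;> rw [h]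
    · simp
    · exact le_mul_of_one_le_left zero_le (by simp)
  exact le_add_self.trans (le_mul_self.trans le_self_add)

theorem pr_le_pr_right (x : N.Dom) {y y' : N.Dom} (h : y ≤ y') : pr x y ≤ pr x y' := by
  unfold pr
  gcongr

theorem add_le_add_of_pr_eq {x y x' y' : N.Dom} (h : pr x y = pr x' y') : x + y ≤ x' + y' := by
  by_contra! hlt
  obtain ⟨z, hz⟩ := Str.lt_iff_exists.1 hlt
  generalize hs : x' + y' = s at hz
  have hx' : x' ≤ s := hs ▸ le_self_add
  refine h.not_gt ?_
  calc pr x' y' = s * s + x' := by rw [pr, hs]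
    _ ≤ s * s + s := by gcongr
    _ < s * s + s + (2 * s * z + s + z * z + 2 * z + x) + 1 := le_self_add.trans_lt (lt_add_one _)
    _ = pr x y := by rw [pr, hz]; ring

theorem pr_inj {x y x' y' : N.Dom} : pr x y = pr x' y' ↔ x = x' ∧ y = y' := by
  refine ⟨fun h => ?_, fun h => by rw [h.1, h.2]⟩
  have hs : x + y = x' + y' := le_antisymm (add_le_add_of_pr_eq h) (add_le_add_of_pr_eq h.symm)
  obtain rfl : x = x' := by
    rw [pr, pr, hs] at h
    exact add_left_cancel h
  exact ⟨rfl, add_left_cancel hs⟩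

/-! ## Codes of finite sets -/

/-- `t` is an element of the finite set coded by `c`. -/
def Elt (t c : N.Dom) : Prop :=
  ∃ k m n, c = pr k (pr m n) ∧ t < k ∧ m * (t + 1) + 1 ∣ n

theorem elt_pr {t k m n : N.Dom} : Elt t (pr k (pr m n)) ↔ t < k ∧ m * (t + 1) + 1 ∣ n := by
  refine ⟨?_, fun ⟨ht, hdvd⟩ => ⟨k, m, n, rfl, ht, hdvd⟩⟩
  rintro ⟨k', m', n', h, ht, hdvd⟩
  simp only [pr_inj] at h
  obtain ⟨rfl, rfl, rfl⟩ := h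
  exact ⟨ht, hdvd⟩

theorem Elt.lt {t c : N.Dom} (h : Elt t c) : t < c := by
  obtain ⟨k, m, n, rfl, ht, -⟩ := h
  exact ht.trans_le (left_le_pr _ _)

@[simp] theorem holds_elt (e : ℕ → N.Dom) (f : ℕ → N.Sets) (t c : Tm) :
    (elt t c).Holds e f ↔ Elt (t.val e) (c.val e) := by
  simp [elt, Elt, dvd_def, eq_comm]

/-- `elt` as a bounded formula. -/
def eltF (t c : Tm) : Fm :=
  bexF (c + 1) (bexF (c.up 1 + 1) (bexF (c.up 2 + 1)
    (c.up 3 ≐ pair ♯2 (pair ♯1 ♯0) ⋏ t.up 3 ≺ ♯2 ⋏ dvdF (♯1 * (t.up 3 + 1) + 1) ♯0)))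

theorem isBounded_eltF (t c : Tm) : IsBounded (eltF t c) :=
  .bexF (.bexF (.bexF (.and (.eq _ _) (.and (.lt _ _) (isBounded_dvdF _ _)))))

@[simp] theorem holds_eltF (e : ℕ → N.Dom) (f : ℕ → N.Sets) (t c : Tm) :
    (eltF t c).Holds e f ↔ Elt (t.val e) (c.val e) := by
  simp only [eltF, holds_bexF, Fm.holds_and, Fm.holds_eq, Fm.holds_lt, Tm.val_add, Tm.val_up,
    Tm.val_one, Tm.val_var, Tm.val_mul, scons_zero, scons_succ, val_pair, holds_dvdF]
  constructor
  · rintro ⟨k, -, m, -, n, -, hc, ht, hdvd⟩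
    exact ⟨k, m, n, hc, ht, hdvd⟩
  · rintro ⟨k, m, n, hc, ht, hdvd⟩
    refine ⟨k, ?_, m, ?_, n, ?_, hc, ht, hdvd⟩ <;> rw [Str.lt_succ_iff, hc]
    · exact left_le_pr _ _
    · exact (left_le_pr _ _).trans (right_le_pr _ _)
    · exact (right_le_pr _ _).trans (right_le_pr _ _)

instance Delta0.elt {g g' : (ℕ → N.Dom) → N.Dom} [TermFun g] [TermFun g'] :
    Delta0 fun e => Elt (g e) (g' e) :=
  .of_formula (isBounded_eltF ♯0 ♯1) default fun _ => holds_eltF _ _ _ _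

theorem exists_common_multiple (b : N.Dom) : ∃ m, m ≠ 0 ∧ ∀ i, i < b → i + 1 ∣ m := by
  refine sigma_induction (P := fun b : N.Dom => ∃ m, m ≠ 0 ∧ ∀ i, i < b → i + 1 ∣ m)
    ⟨1, one_ne_zero, fun i hi => (not_lt_zero hi).elim⟩ ?_ b
  rintro b ⟨m, hm, h⟩
  refine ⟨m * (b + 1), mul_ne_zero hm (Str.succ_ne_zero b), fun i hi => ?_⟩
  rcases (Str.lt_succ_iff.1 hi).lt_or_eq with hi | rfl
  · exact (h i hi).mul_right _
  · exact dvd_mul_left _ _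

theorem exists_multiple_of_moduli (b m : N.Dom) :
    ∃ M, M ≠ 0 ∧ ∀ t, t < b → m * (t + 1) + 1 ∣ M := by
  refine sigma_induction (P := fun b : N.Dom => ∃ M, M ≠ 0 ∧ ∀ t, t < b → m * (t + 1) + 1 ∣ M)
    ⟨1, one_ne_zero, fun i hi => (not_lt_zero hi).elim⟩ ?_ b
  rintro b ⟨M, hM, h⟩
  refine ⟨M * (m * (b + 1) + 1), mul_ne_zero hM (Str.succ_ne_zero _), fun i hi => ?_⟩
  rcases (Str.lt_succ_iff.1 hi).lt_or_eq with hi | rfl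
  · exact (h i hi).mul_right _
  · exact dvd_mul_left _ _

theorem one_lt_modulus {m : N.Dom} (hm : m ≠ 0) (t : N.Dom) : 1 < m * (t + 1) + 1 := by
  simpa using pos_iff_ne_zero.2 hm

theorem modulus_not_dvd_one {m : N.Dom} (hm : m ≠ 0) (t : N.Dom) : ¬ m * (t + 1) + 1 ∣ 1 :=
  fun h => (one_lt_modulus hm t).not_ge (le_of_dvd one_ne_zero h)

theorem exists_dvd_mul_of_dvd_mul_modulus {b m n t t' : N.Dom} (ht : t < b) (ht' : t' < b)
    (hne : t ≠ t') (h : m * (t + 1) + 1 ∣ n * (m * (t' + 1) + 1)) :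
    ∃ d, d < b ∧ m * (t + 1) + 1 ∣ n * m * (d + 1) := by
  rcases hne.lt_or_gt with hlt | hlt <;> obtain ⟨d, rfl⟩ := Str.lt_iff_exists.1 hlt
  · refine ⟨d, (le_add_self.trans le_self_add).trans_lt ht', ?_⟩
    refine dvd_of_dvd_add (x := n * (m * (t + 1) + 1)) ?_ (dvd_mul_left _ _)
    convert h using 1
    ring
  · refine ⟨d, (le_add_self.trans le_self_add).trans_lt ht, ?_⟩
    exact dvd_of_dvd_add (Dvd.intro_left n (by ring)) h

theorem dvd_of_dvd_mul_modulus {b m n t t' : N.Dom} (hm : ∀ i, i < b → i + 1 ∣ m) (ht : t < b)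
    (ht' : t' < b) (hne : t ≠ t') (h : m * (t + 1) + 1 ∣ n * (m * (t' + 1) + 1)) :
    m * (t + 1) + 1 ∣ n := by
  obtain ⟨d, hd, hdvd⟩ := exists_dvd_mul_of_dvd_mul_modulus ht ht' hne h
  exact dvd_of_dvd_mul_of_dvd (Dvd.intro _ rfl)
    (dvd_of_dvd_mul_of_dvd ((hm d hd).mul_right _) hdvd)

theorem exists_move_modulus {b m n k t : N.Dom} (hm : ∀ i, i < b → i + 1 ∣ m) (ht : t < b)
    (h : ∀ t, t < b → m * (t + 1) + 1 ∣ n ∨ m * (t + 1) + 1 ∣ k) (hdvd : ¬ m * (t + 1) + 1 ∣ n) :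
    ∃ k', n * (m * (t + 1) + 1) * k' = n * k ∧
      ∀ t', t' < b → m * (t' + 1) + 1 ∣ n * (m * (t + 1) + 1) ∨ m * (t' + 1) + 1 ∣ k' := by
  obtain ⟨k', rfl⟩ := (h t ht).resolve_left hdvd
  refine ⟨k', mul_assoc _ _ _, fun t' ht' => ?_⟩
  rcases eq_or_ne t' t with rfl | hne
  · exact .inl (dvd_mul_left _ _)
  · refine (h t' ht').imp (fun h => h.mul_right _) fun h => ?_
    rw [mul_comm _ k'] at h
    exact dvd_of_dvd_mul_modulus hm ht' ht hne h

/-- With suitable `m` and `M`, each subset of `[0, k)` that has a code at all has a code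
`(k, (m, n))` where `n` divides `M`; the bound `B` exceeds all these codes. -/
def BoundsCodes (k B : N.Dom) : Prop :=
  ∃ m, m < B ∧ ∃ M, M < B ∧ m ≠ 0 ∧ (∀ i, i < k → i + 1 ∣ m) ∧ M ≠ 0 ∧
    (∀ t, t < k → m * (t + 1) + 1 ∣ M) ∧ pr k (pr m M) < B

theorem exists_boundsCodes (k : N.Dom) : ∃ B, BoundsCodes k B := by
  obtain ⟨m, hm, hdiv⟩ := exists_common_multiple k
  obtain ⟨M, hM, hdvd⟩ := exists_multiple_of_moduli k m
  have hlt : pr m M < pr k (pr m M) + 1 := Str.lt_succ_iff.2 (right_le_pr _ _)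
  exact ⟨pr k (pr m M) + 1, m, (left_le_pr _ _).trans_lt hlt, M, (right_le_pr _ _).trans_lt hlt,
    hm, hdiv, hM, hdvd, lt_add_one _⟩

-- The code is read off a maximal divisor `n` of `M` all of whose moduli belong to elements of `F`.
theorem BoundsCodes.exists_code {k B : N.Dom} (hB : BoundsCodes k B) (F : N.Dom → Prop)
    [Sigma1 fun e => F (e 0)] : ∃ u, u < B ∧ ∀ t, Elt t u ↔ t < k ∧ F t := by
  obtain ⟨m, -, M, -, hm, hdiv, hM, hMdvd, hlt⟩ := hB
  obtain ⟨j, ⟨n, l, hnl, hjn, hF, hsplit⟩, hmax⟩ := sigma_exists_last (b := M)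
    (P := fun j => ∃ n, ∃ l, n * l = M ∧ j ≤ n ∧ (∀ t, t < k → m * (t + 1) + 1 ∣ n → F t) ∧
      ∀ t, t < k → m * (t + 1) + 1 ∣ n ∨ m * (t + 1) + 1 ∣ l)
    ⟨1, M, one_mul M, zero_le, fun t _ h => (modulus_not_dvd_one hm t h).elim,
      fun t ht => .inr (hMdvd t ht)⟩
    fun j ⟨n, l, hnl, hjn, _⟩ => hjn.trans (le_of_dvd hM ⟨l, hnl.symm⟩)
  have hnM : n ≤ M := le_of_dvd hM ⟨l, hnl.symm⟩
  refine ⟨pr k (pr m n), (pr_le_pr_right _ (pr_le_pr_right _ hnM)).trans_lt hlt, fun t => ?_⟩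
  refine elt_pr.trans (and_congr_right fun ht => ⟨hF t ht, fun hFt => ?_⟩)
  by_contra hdvd
  obtain ⟨l', hnl', hsplit'⟩ := exists_move_modulus hdiv ht hsplit hdvd
  refine hmax ⟨_, l', hnl'.trans hnl, Order.add_one_le_of_lt (hjn.trans_lt ?_), ?_, hsplit'⟩
  · exact lt_mul_of_one_lt_right (pos_iff_ne_zero.2 (left_ne_zero_of_mul (hnl ▸ hM)))
      (one_lt_modulus hm t)
  · intro t' ht' h
    rcases eq_or_ne t' t with rfl | hne
    · exact hFt
    · exact hF t' ht' (dvd_of_dvd_mul_modulus hdiv ht' ht hne h)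

/-- `BoundsCodes` as a bounded formula. -/
def boundsCodesF (k b : Tm) : Fm :=
  bexF b (bexF (b.up 1) ((♯1 ≐ 0).neg ⋏ ballF (k.up 2) (dvdF (♯0 + 1) ♯2) ⋏ (♯0 ≐ 0).neg ⋏
    ballF (k.up 2) (dvdF (♯2 * (♯0 + 1) + 1) ♯1) ⋏ pair (k.up 2) (pair ♯1 ♯0) ≺ b.up 2))

theorem isBounded_boundsCodesF (k b : Tm) : IsBounded (boundsCodesF k b) :=
  .bexF (.bexF (.and (IsBounded.eq _ _).neg (.and (.ballF (isBounded_dvdF _ _))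
    (.and (IsBounded.eq _ _).neg (.and (.ballF (isBounded_dvdF _ _)) (.lt _ _))))))

@[simp] theorem holds_boundsCodesF (e : ℕ → N.Dom) (f : ℕ → N.Sets) (k b : Tm) :
    (boundsCodesF k b).Holds e f ↔ BoundsCodes (k.val e) (b.val e) := by
  simp [boundsCodesF, BoundsCodes]

theorem bounded_comprehension (F : N.Dom → Prop) [Sigma1 fun e => F (e 0)] (b : N.Dom) :
    ∃ X : N.Sets, ∀ t, t ∈ X ↔ t < b ∧ F t := by
  obtain ⟨B, hB⟩ := exists_boundsCodes b
  obtain ⟨u, -, hu⟩ := hB.exists_code F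
  obtain ⟨X, hX⟩ := delta_comprehension (P := fun t => Elt t u)
  exact ⟨X, fun t => (hX t).trans (hu t)⟩

theorem comprehension_of_existsUnique {G Q : N.Dom → N.Dom → Prop}
    [hG : Delta0 fun e => G (e 0) (e 1)] [hQ : Delta0 fun e => Q (e 0) (e 1)]
    (h : ∀ x, ∃! p, G x p) : ∃ X : N.Sets, ∀ x, x ∈ X ↔ ∃ p, G x p ∧ Q x p := by
  have hG' : Delta0 fun e => G (e 1) (e 0) := hG.comp₂
  have hQ' : Delta0 fun e => Q (e 1) (e 0) := hQ.comp₂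
  have hcompl : Sigma1 fun e => ¬ ∃ p, G (e 0) p ∧ Q (e 0) p := by
    refine (inferInstance : Sigma1 fun e => ∃ p, G (e 0) p ∧ ¬ Q (e 0) p).congr fun e => ?_
    obtain ⟨p, hp, huniq⟩ := h (e 0)
    constructor
    · exact fun hQ => ⟨p, hp, fun hpQ => hQ ⟨p, hp, hpQ⟩⟩
    · rintro ⟨q, hq, hnQ⟩ ⟨q', hq', hQ⟩
      obtain rfl := (huniq q hq).trans (huniq q' hq').symm
      exact hnQ hQ
  exact delta_comprehension (P := fun x => ∃ p, G x p ∧ Q x p)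

-- `x` is put into the set if it has a witness below the first stage at which a pair of some
-- `y ≥ x` and its witness has appeared.
theorem exists_unbounded_subset {R : N.Dom → N.Dom → Prop} [hR : Delta0 fun e => R (e 0) (e 1)]
    (h : ∀ b, ∃ x, b ≤ x ∧ ∃ w, R w x) :
    ∃ X : N.Sets, (∀ b, ∃ x, b ≤ x ∧ x ∈ X) ∧ ∀ x, x ∈ X → ∃ w, R w x := by
  let Appears : N.Dom → N.Dom → Prop := fun x p => ∃ y, y < p ∧ x ≤ y ∧ ∃ w, w < p ∧ R w y
  have hstage : ∀ x, ∃! p, Appears x p ∧ ∀ q, q < p → ¬ Appears x q := by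
    intro x
    obtain ⟨y, hxy, w, hw⟩ := h x
    exact delta_existsUnique_least (P := Appears x) (a := max y w + 1)
      ⟨y, by simp, hxy, w, by simp, hw⟩
  obtain ⟨X, hX⟩ := comprehension_of_existsUnique (Q := fun x p => ∃ w, w < p ∧ R w x) hstage
  refine ⟨X, fun b => ?_, fun x hx => ?_⟩
  · obtain ⟨p, ⟨y, -, hby, w, hwp, hw⟩, hmin⟩ := (hstage b).exists
    obtain ⟨q, ⟨z, hzq, hyz, v, hvq, hv⟩, hqmin⟩ := (hstage y).exists
    have hpq : p ≤ q := not_lt.1 fun hqp => hmin q hqp ⟨z, hzq, hby.trans hyz, v, hvq, hv⟩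
    exact ⟨y, hby, (hX y).2 ⟨q, ⟨⟨z, hzq, hyz, v, hvq, hv⟩, hqmin⟩, w, hwp.trans_le hpq, hw⟩⟩
  · obtain ⟨p, -, w, -, hw⟩ := (hX x).1 hx
    exact ⟨w, hw⟩

end Coding

/-! ## Relations and satisfaction -/

section TruthValues

/-- The proposition `p` has the truth value `c`. -/
def Val (c : Bool) (p : Prop) : Prop := if c then p else ¬ p

/-- Conjunction for `c = true`, disjunction for `c = false`. -/
def Comb (c : Bool) (p q : Prop) : Prop := if c then p ∧ q else p ∨ q

theorem val_not {c : Bool} {p : Prop} : Val (!c) p ↔ ¬ Val c p := by cases c <;> simp [Val]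

theorem val_congr {c : Bool} {p q : Prop} (h : p ↔ q) : Val c p ↔ Val c q := by rw [h]

theorem val_comb {c : Bool} {p q : Prop} :
    Val (!c) (Comb c p q) ↔ Val (!c) p ∨ Val (!c) q := by
  cases c
  · exact Iff.rfl
  · exact not_and_or

variable {N : Str} {c : Bool} {P Q : (ℕ → N.Dom) → Prop}

instance Delta0.val [h : Delta0 P] : Delta0 fun e => Val c (P e) := by
  cases c
  · exact (inferInstance : Delta0 fun e => ¬ P e)
  · exact h

instance Delta0.comb [Delta0 P] [Delta0 Q] : Delta0 fun e => Comb c (P e) (Q e) := by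
  cases c
  · exact (inferInstance : Delta0 fun e => P e ∨ Q e)
  · exact (inferInstance : Delta0 fun e => P e ∧ Q e)

@[simp] theorem holds_hasValue (e : ℕ → N.Dom) (f : ℕ → N.Sets) (X : ℕ) (t : Tm) :
    (hasValue c X t).Holds e f ↔ Val c (t.val e ∈ f X) := by
  cases c <;> simp [hasValue, Val]

end TruthValues

section Relations

variable {N : Str} [hN : N.IsRCA] {c : Bool}

/-- The vector `v` is in the relation `(n, r)`. -/
def VecMem (n r v : N.Dom) : Prop := ∃ u, Elt u r ∧ ∀ i, i < n → (Elt i u ↔ Elt i v)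

/-- The finite set `p` has at most one element. -/
def AtMostOne (p : N.Dom) : Prop := ∀ i j, Elt i p → Elt j p → i = j

/-- All elements of the finite set `p` are less than `n`. -/
def Below (p n : N.Dom) : Prop := ∀ i, Elt i p → i < n

/-- `h` is a conjunction of horn (`c = true`) or co-horn clauses in `n` variables. -/
def IsHornFormula (c : Bool) (n h : N.Dom) : Prop :=
  ∀ d, Elt d h → ∃ p q, d = pr p q ∧ Below p n ∧ Below q n ∧ AtMostOne (if c then p else q)

/-- The vector `v` satisfies the conjunction of clauses `h`. -/
def CnfTrue (h v : N.Dom) : Prop :=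
  ∀ p q, Elt (pr p q) h → (∃ i, Elt i p ∧ Elt i v) ∨ ∃ i, Elt i q ∧ ¬ Elt i v

/-- `t` codes a horn (`c = true`) or co-horn relation. -/
def IsHornRel (c : Bool) (t : N.Dom) : Prop :=
  ∃ n r h, t = pr n r ∧ IsHornFormula c n h ∧ ∀ v, VecMem n r v ↔ CnfTrue h v

/-- `t` is a formula over the set `V` of variables, with a relation in the class `R`. -/
def IsSFormula (R : N.Dom → Prop) (V : N.Sets) (t : N.Dom) : Prop :=
  ∃ n r y, t = pr (pr n r) y ∧ R (pr n r) ∧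
    ∀ i, i < n → ∃ z, z ∈ V ∧ ∀ w, Elt (pr i w) y ↔ w = z

/-- The assignment given by the class `X` satisfies the formula `t`. -/
def Sat (X : N.Dom → Prop) (t : N.Dom) : Prop :=
  ∃ n r y v, t = pr (pr n r) y ∧ VecMem n r v ∧
    ∀ i, i < n → (Elt i v ↔ ∃ z, Elt (pr i z) y ∧ X z)

section Evaluation

variable (e : ℕ → N.Dom) (f : ℕ → N.Sets)

@[simp] theorem holds_vecMem (n r v : Tm) :
    (vecMem n r v).Holds e f ↔ VecMem (n.val e) (r.val e) (v.val e) := by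
  simp [vecMem, VecMem]

@[simp] theorem holds_atMostOne (p : Tm) : (atMostOne p).Holds e f ↔ AtMostOne (p.val e) := by
  simp [atMostOne, AtMostOne]

@[simp] theorem holds_below (p n : Tm) : (below p n).Holds e f ↔ Below (p.val e) (n.val e) := by
  simp [below, Below]

@[simp] theorem holds_isHornFormula (n h : Tm) :
    (isHornFormula c n h).Holds e f ↔ IsHornFormula c (n.val e) (h.val e) := by
  cases c <;> simp [isHornFormula, IsHornFormula]

@[simp] theorem holds_cnfTrue (h v : Tm) :
    (cnfTrue h v).Holds e f ↔ CnfTrue (h.val e) (v.val e) := by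
  simp [cnfTrue, CnfTrue]

@[simp] theorem holds_isHornRel (t : Tm) : (isHornRel c t).Holds e f ↔ IsHornRel c (t.val e) := by
  simp [isHornRel, IsHornRel]

@[simp] theorem holds_isSFormula (σ : Fm) (k s V : ℕ) (t : Tm) :
    (isSFormula σ k s V t).Holds e f ↔
      IsSFormula (fun x => σ.Holds (scons x fun i => e (i + k)) fun i => f (i + s)) (f V)
        (t.val e) := by
  simp [isSFormula, IsSFormula, ← add_assoc]

@[simp] theorem holds_sat (X : ℕ) (t : Tm) : (sat X t).Holds e f ↔ Sat (· ∈ f X) (t.val e) := by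
  simp [sat, Sat]

end Evaluation

theorem CnfTrue.comb {n h v₁ v₂ v : N.Dom} (hh : IsHornFormula c n h) (h₁ : CnfTrue h v₁)
    (h₂ : CnfTrue h v₂) (hv : ∀ i, i < n → (Elt i v ↔ Comb c (Elt i v₁) (Elt i v₂))) :
    CnfTrue h v := by
  intro p q hpq
  obtain ⟨p', q', heq, hp, hq, hone⟩ := hh _ hpq
  obtain ⟨rfl, rfl⟩ := pr_inj.1 heq
  cases c
  · replace hv : ∀ i, i < n → (Elt i v ↔ Elt i v₁ ∨ Elt i v₂) := hv
    rcases h₁ p q hpq with ⟨i, hip, hi₁⟩ | ⟨i, hiq, hi₁⟩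
    · exact .inl ⟨i, hip, (hv i (hp i hip)).2 (.inl hi₁)⟩
    rcases h₂ p q hpq with ⟨j, hjp, hj₂⟩ | ⟨j, hjq, hj₂⟩
    · exact .inl ⟨j, hjp, (hv j (hp j hjp)).2 (.inr hj₂)⟩
    obtain rfl := hone i j hiq hjq
    exact .inr ⟨i, hiq, fun hi => ((hv i (hq i hiq)).1 hi).elim hi₁ hj₂⟩
  · replace hv : ∀ i, i < n → (Elt i v ↔ Elt i v₁ ∧ Elt i v₂) := hv
    rcases h₁ p q hpq with ⟨i, hip, hi₁⟩ | ⟨i, hiq, hi₁⟩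
    · rcases h₂ p q hpq with ⟨j, hjp, hj₂⟩ | ⟨j, hjq, hj₂⟩
      · obtain rfl := hone i j hip hjp
        exact .inl ⟨i, hip, (hv i (hp i hip)).2 ⟨hi₁, hj₂⟩⟩
      · exact .inr ⟨j, hjq, fun hj => hj₂ ((hv j (hq j hjq)).1 hj).2⟩
    · exact .inr ⟨i, hiq, fun hi => hi₁ ((hv i (hq i hiq)).1 hi).1⟩

variable {R : N.Dom → Prop} {V : N.Sets} {X Y : N.Dom → Prop}

theorem Sat.comb {t : N.Dom} (hR : ∀ t, R t → IsHornRel c t) (ht : IsSFormula R V t)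
    (hX : Sat X t) (hY : Sat Y t) : Sat (fun z => Comb c (X z) (Y z)) t := by
  obtain ⟨n, r, y, rfl, hnr, hy⟩ := ht
  obtain ⟨n', r', h, heq, hh, hcnf⟩ := hR _ hnr
  obtain ⟨rfl, rfl⟩ := pr_inj.1 heq
  obtain ⟨_, _, _, v₁, heq₁, hv₁, hX⟩ := hX
  obtain ⟨_, _, _, v₂, heq₂, hv₂, hY⟩ := hY
  simp only [pr_inj] at heq₁ heq₂
  obtain ⟨⟨rfl, rfl⟩, rfl⟩ := heq₁
  obtain ⟨⟨rfl, rfl⟩, rfl⟩ := heq₂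
  obtain ⟨B, hB⟩ := exists_boundsCodes n
  obtain ⟨v, -, hv⟩ := hB.exists_code fun i => Comb c (Elt i v₁) (Elt i v₂)
  have hv_iff : ∀ i, i < n → (Elt i v ↔ Comb c (Elt i v₁) (Elt i v₂)) := fun i hi =>
    (hv i).trans (and_iff_right hi)
  refine ⟨n, r, y, v, rfl, (hcnf v).2 (((hcnf v₁).1 hv₁).comb hh ((hcnf v₂).1 hv₂) hv_iff),
    fun i hi => ?_⟩
  obtain ⟨z, -, hz⟩ := hy i hi
  have value_eq : ∀ Z : N.Dom → Prop, (∃ w, Elt (pr i w) y ∧ Z w) ↔ Z z := fun Z => by simp [hz]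
  rw [value_eq, hv_iff i hi, hX i hi, hY i hi, value_eq, value_eq]

theorem sat_congr {t : N.Dom} (h : ∀ z, z < t → (X z ↔ Y z)) : Sat X t ↔ Sat Y t := by
  refine exists_congr fun n => exists_congr fun r => exists_congr fun y => exists_congr fun v =>
    and_congr_right fun ht => and_congr_right fun _ => forall₂_congr fun i _ =>
    iff_congr Iff.rfl (exists_congr fun z => and_congr_right fun hz => h z ?_)
  rw [ht]
  exact ((right_le_pr _ _).trans_lt hz.lt).trans_le (right_le_pr _ _)

theorem sat_iff_bounded {t : N.Dom} :
    Sat X t ↔ ∃ n, n < t + 1 ∧ ∃ r, r < t + 1 ∧ ∃ y, y < t + 1 ∧ t = pr (pr n r) y ∧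
      ∃ u, u < r ∧ Elt u r ∧ ∀ i, i < n → (Elt i u ↔ ∃ z, z < y ∧ Elt (pr i z) y ∧ X z) := by
  have value_iff : ∀ {i y}, (∃ z, Elt (pr i z) y ∧ X z) ↔ ∃ z, z < y ∧ Elt (pr i z) y ∧ X z :=
    exists_congr fun z => (and_iff_right_of_imp fun h => (right_le_pr _ _).trans_lt h.1.lt).symm
  simp only [Sat, value_iff]
  constructor
  · rintro ⟨n, r, y, v, rfl, ⟨u, hu, huv⟩, hv⟩
    refine ⟨n, ?_, r, ?_, y, ?_, rfl, u, hu.lt, hu, fun i hi => (huv i hi).trans (hv i hi)⟩ <;>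
      rw [Str.lt_succ_iff]
    · exact (left_le_pr _ _).trans (left_le_pr _ _)
    · exact (right_le_pr _ _).trans (left_le_pr _ _)
    · exact right_le_pr _ _
  · rintro ⟨n, -, r, -, y, -, ht, u, -, hu, h⟩
    exact ⟨n, r, y, u, ht, ⟨u, hu, fun _ _ => Iff.rfl⟩, h⟩

/-- The finite set coded by `u` satisfies the formula `t`, as a bounded formula. -/
def satF (u t : Tm) : Fm :=
  bexF (t + 1) (bexF (t.up 1 + 1) (bexF (t.up 2 + 1)
    (t.up 3 ≐ pair (pair ♯2 ♯1) ♯0 ⋏ bexF ♯1 (eltF ♯0 ♯2 ⋏ ballF ♯3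
      (eltF ♯0 ♯1 ⟺ bexF ♯2 (eltF (pair ♯1 ♯0) ♯3 ⋏ eltF ♯0 (u.up 6)))))))

theorem isBounded_satF (u t : Tm) : IsBounded (satF u t) :=
  .bexF (.bexF (.bexF (.and (.eq _ _) (.bexF (.and (isBounded_eltF _ _) (.ballF
    (.iff (isBounded_eltF _ _) (.bexF (.and (isBounded_eltF _ _) (isBounded_eltF _ _))))))))))

@[simp] theorem holds_satF (e : ℕ → N.Dom) (f : ℕ → N.Sets) (u t : Tm) :
    (satF u t).Holds e f ↔ Sat (Elt · (u.val e)) (t.val e) := by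
  simp [satF, sat_iff_bounded]

/-- The assignment given by the class `X` satisfies the formulas in `C` below `k`. -/
def SatBelow (C : N.Sets) (k : N.Dom) (X : N.Dom → Prop) : Prop := ∀ t, t < k → t ∈ C → Sat X t

/-- The finite set coded by `u` satisfies the formulas below `k` in the set `C`, as a bounded
formula. -/
def satBelowF (C : ℕ) (k u : Tm) : Fm := ballF k (♯0 ε C ➔ satF (u.up 1) ♯0)

theorem isBounded_satBelowF (C : ℕ) (k u : Tm) : IsBounded (satBelowF C k u) :=
  .ballF (.imp (.mem _ _) (isBounded_satF _ _))

@[simp] theorem holds_satBelowF (e : ℕ → N.Dom) (f : ℕ → N.Sets) (C : ℕ) (k u : Tm) :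
    (satBelowF C k u).Holds e f ↔ SatBelow (f C) (k.val e) (Elt · (u.val e)) := by
  simp [satBelowF, SatBelow]

instance Delta0.satBelow (C : N.Sets) {g g' : (ℕ → N.Dom) → N.Dom} [TermFun g] [TermFun g'] :
    Delta0 fun e => SatBelow C (g e) (Elt · (g' e)) :=
  .of_formula (R := fun k u => SatBelow C k (Elt · u)) (isBounded_satBelowF 0 ♯0 ♯1) (fun _ => C)
    fun _ => holds_satBelowF _ _ _ _ _

variable {C : N.Sets} {k k' B : N.Dom}

theorem SatBelow.mono (h : SatBelow C k X) (hk : k' ≤ k) : SatBelow C k' X :=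
  fun t ht => h t (ht.trans_le hk)

theorem satBelow_congr (h : ∀ z, z < k → (X z ↔ Y z)) : SatBelow C k X ↔ SatBelow C k Y :=
  forall₃_congr fun _ ht _ => sat_congr fun z hz => h z (hz.trans ht)

theorem SatBelow.comb (hR : ∀ t, R t → IsHornRel c t) (hform : ∀ t, t ∈ C → IsSFormula R V t)
    (hX : SatBelow C k X) (hY : SatBelow C k Y) : SatBelow C k fun z => Comb c (X z) (Y z) :=
  fun t ht htC => (hX t ht htC).comb hR (hform t htC) (hY t ht htC)

theorem SatBelow.exists_code (hB : BoundsCodes k B) [Sigma1 fun e => X (e 0)]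
    (hX : SatBelow C k X) :
    ∃ u, u < B ∧ SatBelow C k (Elt · u) ∧ ∀ i, i < k → (Elt i u ↔ X i) := by
  obtain ⟨u, hu, hiff⟩ := hB.exists_code X
  have hX_iff : ∀ i, i < k → (Elt i u ↔ X i) := fun i hi => (hiff i).trans (and_iff_right hi)
  exact ⟨u, hu, (satBelow_congr hX_iff).2 hX, hX_iff⟩

end Relations

/-! ## Homogeneous sets -/

section Notions

variable {N : Str}

/-- The class `F` is finite, that is, bounded. -/
def FiniteClass (F : N.Dom → Prop) : Prop := ∃ b, ∀ x, F x → x < b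

/-- `F` is a finite subset of `C`. -/
def FiniteSubset (F C : N.Sets) : Prop := (∀ x, x ∈ F → x ∈ C) ∧ FiniteClass (· ∈ F)

section Evaluation

variable (e : ℕ → N.Dom) (f : ℕ → N.Sets)

@[simp] theorem holds_subset (X Y : ℕ) : (subset X Y).Holds e f ↔ ∀ x, x ∈ f X → x ∈ f Y := by
  simp [subset]

@[simp] theorem holds_finClass (φ : Fm) :
    (finClass φ).Holds e f ↔ FiniteClass fun x => φ.Holds (scons x e) f := by
  simp [finClass, FiniteClass]

@[simp] theorem holds_finite (X : ℕ) : (finite X).Holds e f ↔ FiniteClass (· ∈ f X) := by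
  simp [finite]

@[simp] theorem holds_infinite (X : ℕ) : (infinite X).Holds e f ↔ ¬ FiniteClass (· ∈ f X) := by
  simp [infinite]

end Evaluation

variable [hN : N.IsRCA]

theorem not_finiteClass_iff {F : N.Dom → Prop} :
    ¬ FiniteClass F ↔ ∀ b, ∃ x, b ≤ x ∧ F x := by
  simp only [FiniteClass, not_exists, not_forall, not_lt, exists_prop, and_comm]

/-- The assignment `X` satisfies the formulas in `F`. -/
def SatAll (X F : N.Sets) : Prop := ∀ t, t ∈ F → Sat (· ∈ X) t

/-- Each finite subset of `C` is satisfiable. -/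
def FinSat (C : N.Sets) : Prop := ∀ F, FiniteSubset F C → ∃ X, SatAll X F

/-- `H` is homogeneous for `C` with color `c`. -/
def HomogeneousWith (c : Bool) (H C : N.Sets) : Prop :=
  ∀ F, FiniteSubset F C → ∃ X, SatAll X F ∧ ∀ a, a ∈ H → Val c (a ∈ X)

/-- The variable `x` is in `L`, and a finite subset of `C` forces it to have the value `c`. -/
def Forced (c : Bool) (C L : N.Sets) (x : N.Dom) : Prop :=
  x ∈ L ∧ ∃ F, FiniteSubset F C ∧ ∀ X, SatAll X F → Val c (x ∈ X)

variable (e : ℕ → N.Dom) (f : ℕ → N.Sets) (c : Bool)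

@[simp] theorem holds_satAll (X C : ℕ) : (satAll X C).Holds e f ↔ SatAll (f X) (f C) := by
  simp [satAll, SatAll]

@[simp] theorem holds_finSat (C : ℕ) : (finSat C).Holds e f ↔ FinSat (f C) := by
  simp [finSat, FinSat, FiniteSubset]

@[simp] theorem holds_homogeneousWith (H C : ℕ) :
    (homogeneousWith c H C).Holds e f ↔ HomogeneousWith c (f H) (f C) := by
  simp [homogeneousWith, HomogeneousWith, FiniteSubset]

@[simp] theorem holds_forced (C L : ℕ) :
    (forced c C L).Holds e f ↔ Forced c (f C) (f L) (e 0) := by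
  simp [forced, Forced, FiniteSubset, and_assoc]

@[simp] theorem holds_allHorn (σ : Fm) :
    (allHorn c σ).Holds e f ↔ ∀ t, σ.Holds (scons t e) f → IsHornRel c t := by
  simp [allHorn]

theorem holds_isInstance (σ : Fm) (V C L : N.Sets) :
    (isInstance σ).Holds e (scons L (scons C (scons V f))) ↔
      ¬ FiniteClass (· ∈ V) ∧
        (∀ t, t ∈ C → IsSFormula (fun x => σ.Holds (scons x e) f) V t) ∧
        FinSat C ∧ ¬ FiniteClass (· ∈ L) ∧ ∀ x, x ∈ L → x ∈ V := by
  simp [isInstance]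

end Notions

/-! ## Forced variables -/

section Forcing

variable {N : Str} [hN : N.IsRCA] {c : Bool} {C L : N.Sets} {b w x : N.Dom}

/-- The bound `w` suffices to verify that `x` is forced: for some `k < w`, all assignments on
`[0, k)`, which have codes below `w`, give the value `c` to `x` if they satisfy `C` below `k`. -/
def ForcedBy (c : Bool) (C L : N.Sets) (w x : N.Dom) : Prop :=
  x ∈ L ∧ ∃ k, k < w ∧ ∃ B, B < w ∧ x < k ∧ BoundsCodes k B ∧
    ∀ u, u < B → SatBelow C k (Elt · u) → Val c (Elt x u)

/-- `ForcedBy c C L w x` as a bounded formula; `w` and `x` are the number variables `0` and `1`, and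
`L` and `C` are the set variables `0` and `1`. -/
def forcedByF (c : Bool) : Fm :=
  ♯1 ε 0 ⋏ bexF ♯0 (bexF ♯1 (♯3 ≺ ♯1 ⋏ boundsCodesF ♯1 ♯0 ⋏
    ballF ♯0 (satBelowF 1 ♯2 ♯0 ➔ if c then eltF ♯4 ♯0 else (eltF ♯4 ♯0).neg)))

theorem isBounded_forcedByF (c : Bool) : IsBounded (forcedByF c) := by
  refine .and (.mem _ _) (.bexF (.bexF (.and (.lt _ _) (.and (isBounded_boundsCodesF _ _)
    (.ballF (.imp (isBounded_satBelowF _ _ _) ?_))))))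
  cases c
  · exact (isBounded_eltF _ _).neg
  · exact isBounded_eltF _ _

theorem holds_forcedByF (e : ℕ → N.Dom) (f : ℕ → N.Sets) (c : Bool) :
    (forcedByF c).Holds e f ↔ ForcedBy c (f 1) (f 0) (e 0) (e 1) := by
  cases c <;> simp [forcedByF, ForcedBy, Val]

instance Delta0.forcedBy (c : Bool) (C L : N.Sets) {g g' : (ℕ → N.Dom) → N.Dom} [TermFun g]
    [TermFun g'] : Delta0 fun e => ForcedBy c C L (g e) (g' e) :=
  .of_formula (isBounded_forcedByF c) (scons L fun _ => C) fun _ => holds_forcedByF _ _ _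

theorem exists_finiteSubset (C : N.Sets) (b : N.Dom) :
    ∃ F, FiniteSubset F C ∧ ∀ X : N.Sets, SatAll X F ↔ SatBelow C b (· ∈ X) := by
  obtain ⟨F, hF⟩ := bounded_comprehension (· ∈ C) b
  refine ⟨F, ⟨fun x hx => ((hF x).1 hx).2, b, fun x hx => ((hF x).1 hx).1⟩, fun X => ?_⟩
  simp only [SatAll, SatBelow, hF, and_imp]

theorem FiniteSubset.exists_satBelow_imp {F : N.Sets} (hF : FiniteSubset F C) :
    ∃ b, ∀ X : N.Sets, SatBelow C b (· ∈ X) → SatAll X F := by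
  obtain ⟨hFC, b, hb⟩ := hF
  exact ⟨b, fun X hX t ht => hX t (hb t ht) (hFC t ht)⟩

theorem FinSat.exists_satBelow (h : FinSat C) (b : N.Dom) :
    ∃ X : N.Sets, SatBelow C b (· ∈ X) := by
  obtain ⟨F, hF, hsat⟩ := exists_finiteSubset C b
  obtain ⟨X, hX⟩ := h F hF
  exact ⟨X, (hsat X).1 hX⟩

theorem ForcedBy.val (h : ForcedBy c C L w x) {X : N.Sets} (hX : SatBelow C w (· ∈ X)) :
    Val c (x ∈ X) := by
  obtain ⟨-, k, hk, B, -, hxk, hB, hforced⟩ := h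
  obtain ⟨u, hu, hsat, hiff⟩ := (hX.mono hk.le).exists_code hB
  exact (val_congr (hiff x hxk)).1 (hforced u hu hsat)

theorem exists_set_elt (u : N.Dom) : ∃ X : N.Sets, ∀ z, z ∈ X ↔ Elt z u :=
  delta_comprehension

theorem exists_forcedBy (hx : x ∈ L)
    (h : ∀ X : N.Sets, SatBelow C b (· ∈ X) → Val c (x ∈ X)) : ∃ w, ForcedBy c C L w x := by
  obtain ⟨B, hB⟩ := exists_boundsCodes (max b (x + 1))
  refine ⟨max (max b (x + 1)) B + 1, hx, _, Str.lt_succ_iff.2 (le_max_left _ _), B,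
    Str.lt_succ_iff.2 (le_max_right _ _), lt_max_of_lt_right (lt_add_one x), hB,
    fun u _ hsat => ?_⟩
  obtain ⟨X, hX⟩ := exists_set_elt u
  exact (val_congr (hX x)).1
    (h X ((satBelow_congr fun z _ => hX z).2 (hsat.mono (le_max_left _ _))))

theorem forced_iff : Forced c C L x ↔ ∃ w, ForcedBy c C L w x := by
  constructor
  · rintro ⟨hx, F, hF, hforced⟩
    obtain ⟨b, hb⟩ := hF.exists_satBelow_imp
    exact exists_forcedBy hx fun X hX => hforced X (hb X hX)
  · rintro ⟨w, hw⟩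
    obtain ⟨F, hF, hsat⟩ := exists_finiteSubset C w
    exact ⟨hw.1, F, hF, fun X hX => hw.val ((hsat X).1 hX)⟩

theorem exists_satBelow_of_not_forced (hx : x ∈ L) (h : ¬ Forced c C L x) (b : N.Dom) :
    ∃ X : N.Sets, SatBelow C b (· ∈ X) ∧ Val (!c) (x ∈ X) := by
  by_contra! hval
  exact h (forced_iff.2 (exists_forcedBy hx fun X hX => not_not.1 (mt val_not.2 (hval X hX))))

end Forcing

/-! ## Construction of homogeneous sets -/

section Construction

variable {N : Str} [hN : N.IsRCA] {c : Bool} {R : N.Dom → Prop} {V C L H : N.Sets}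

theorem exists_val_of_ge (c : Bool) (X : N.Sets) (b : N.Dom) :
    ∃ Y : N.Sets, (∀ z, z < b → (z ∈ Y ↔ z ∈ X)) ∧ ∀ z, b ≤ z → Val c (z ∈ Y) := by
  cases c
  · obtain ⟨Y, hY⟩ := delta_comprehension (P := fun z => z ∈ X ∧ z < b)
    exact ⟨Y, fun z hz => by simp [hY, hz], fun z hz => by simp [Val, hY, hz]⟩
  · obtain ⟨Y, hY⟩ := delta_comprehension (P := fun z => z ∈ X ∨ b ≤ z)
    exact ⟨Y, fun z hz => by simp [hY, hz], fun z hz => by simp [Val, hY, hz]⟩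

theorem homogeneousWith_of_forall_lt (h : ∀ b : N.Dom, ∃ X : N.Sets,
    SatBelow C b (· ∈ X) ∧ ∀ a, a < b → a ∈ H → Val c (a ∈ X)) : HomogeneousWith c H C := by
  intro F hF
  obtain ⟨b, hb⟩ := hF.exists_satBelow_imp
  obtain ⟨X, hX, hval⟩ := h b
  obtain ⟨Y, hlt, hge⟩ := exists_val_of_ge c X b
  refine ⟨Y, hb Y ((satBelow_congr hlt).2 hX), fun a ha => ?_⟩
  rcases lt_or_ge a b with hab | hab
  · exact (val_congr (hlt a hab)).2 (hval a hab ha)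
  · exact hge a hab

theorem homogeneousWith_of_forced (hC : FinSat C) (hH : ∀ x, x ∈ H → Forced c C L x) :
    HomogeneousWith c H C := by
  refine homogeneousWith_of_forall_lt fun b => ?_
  have hwitness : ∀ x, x < b → ∃ w, x ∈ H → ForcedBy c C L w x := fun x _ => by
    by_cases hx : x ∈ H
    · obtain ⟨w, hw⟩ := forced_iff.1 (hH x hx)
      exact ⟨w, fun _ => hw⟩
    · exact ⟨0, fun h => (hx h).elim⟩
  obtain ⟨B, hB⟩ := delta_collection (R := fun w x => x ∈ H → ForcedBy c C L w x) b hwitness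
  obtain ⟨X, hX⟩ := hC.exists_satBelow (max b B)
  refine ⟨X, hX.mono (le_max_left _ _), fun a hab ha => ?_⟩
  obtain ⟨w, hw, hforced⟩ := hB a hab
  exact (hforced ha).val (hX.mono (hw.le.trans (le_max_right _ _)))

theorem exists_satBelow_forall_lt (hR : ∀ t, R t → IsHornRel c t)
    (hform : ∀ t, t ∈ C → IsSFormula R V t) {b : N.Dom}
    (h : ∀ x, ∃ X : N.Sets, SatBelow C b (· ∈ X) ∧ (x ∈ H → Val (!c) (x ∈ X))) :
    ∃ X : N.Sets, SatBelow C b (· ∈ X) ∧ ∀ x, x < b → x ∈ H → Val (!c) (x ∈ X) := by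
  obtain ⟨B, hB⟩ := exists_boundsCodes b
  obtain ⟨u, -, hsat, hval⟩ : ∃ u, u < B ∧ SatBelow C b (Elt · u) ∧
      ∀ x, x < b → x < b → x ∈ H → Val (!c) (Elt x u) := by
    refine Str.delta_induction (P := fun j => ∃ u, u < B ∧ SatBelow C b (Elt · u) ∧
      ∀ x, x < j → x < b → x ∈ H → Val (!c) (Elt x u)) ?_ ?_ b
    · obtain ⟨X, hX, -⟩ := h 0
      obtain ⟨u, hu, hsat, -⟩ := hX.exists_code hB
      exact ⟨u, hu, hsat, fun x hx => (not_lt_zero hx).elim⟩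
    · rintro j ⟨u, -, hsat, hval⟩
      obtain ⟨X, hX, hjX⟩ := h j
      obtain ⟨v, hv, hvsat, hiff⟩ := (hsat.comb hR hform hX).exists_code hB
      refine ⟨v, hv, hvsat, fun x hx hxb hxH => ?_⟩
      rw [val_congr (hiff x hxb), val_comb]
      rcases (Str.lt_succ_iff.1 hx).lt_or_eq with hx | rfl
      · exact .inl (hval x hx hxb hxH)
      · exact .inr (hjX hxH)
  obtain ⟨X, hX⟩ := exists_set_elt u
  exact ⟨X, (satBelow_congr fun z _ => hX z).2 hsat,
    fun x hx hxH => (val_congr (hX x)).2 (hval x hx hx hxH)⟩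

theorem homogeneousWith_of_not_forced (hR : ∀ t, R t → IsHornRel c t)
    (hform : ∀ t, t ∈ C → IsSFormula R V t) (hC : FinSat C)
    (hH : ∀ x, x ∈ H → x ∈ L ∧ ¬ Forced c C L x) : HomogeneousWith (!c) H C := by
  refine homogeneousWith_of_forall_lt fun b => exists_satBelow_forall_lt hR hform fun x => ?_
  by_cases hx : x ∈ H
  · obtain ⟨X, hX, hval⟩ := exists_satBelow_of_not_forced (hH x hx).1 (hH x hx).2 b
    exact ⟨X, hX, fun _ => hval⟩
  · obtain ⟨X, hX⟩ := hC.exists_satBelow b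
    exact ⟨X, hX, fun h => (hx h).elim⟩

theorem exists_infinite_forced (hF : ¬ FiniteClass (Forced c C L)) :
    ∃ H : N.Sets, ¬ FiniteClass (· ∈ H) ∧ ∀ x, x ∈ H → Forced c C L x := by
  simp only [forced_iff, not_finiteClass_iff] at hF ⊢
  exact exists_unbounded_subset hF

theorem exists_infinite_not_forced (hF : FiniteClass (Forced c C L))
    (hL : ¬ FiniteClass (· ∈ L)) :
    ∃ H : N.Sets, ¬ FiniteClass (· ∈ H) ∧ ∀ x, x ∈ H ↔ x ∈ L ∧ ¬ Forced c C L x := by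
  obtain ⟨b, hb⟩ := hF
  obtain ⟨F, hFmem⟩ := bounded_comprehension (fun x => ∃ w, ForcedBy c C L w x) b
  obtain ⟨H, hH⟩ := delta_comprehension (P := fun x => x ∈ L ∧ ¬ x ∈ F)
  have hmem : ∀ x, x ∈ H ↔ x ∈ L ∧ ¬ Forced c C L x := fun x => by
    rw [hH, hFmem, ← forced_iff]
    exact and_congr_right fun _ => not_congr (and_iff_right_of_imp (hb x))
  refine ⟨H, not_finiteClass_iff.2 fun a => ?_, hmem⟩
  obtain ⟨x, hx, hxL⟩ := not_finiteClass_iff.1 hL (max a b)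
  exact ⟨x, (le_max_left _ _).trans hx, (hmem x).2 ⟨hxL, fun hforced =>
    (hb x hforced).not_ge ((le_max_right _ _).trans hx)⟩⟩

theorem exists_homogeneous (hR : ∀ t, R t → IsHornRel c t)
    (hform : ∀ t, t ∈ C → IsSFormula R V t) (hC : FinSat C) (hL : ¬ FiniteClass (· ∈ L)) :
    ∃ H : N.Sets, ¬ FiniteClass (· ∈ H) ∧ (∀ x, x ∈ H → x ∈ L) ∧
      ((¬ FiniteClass (Forced c C L) ∧ (∀ x, x ∈ H → Forced c C L x) ∧ HomogeneousWith c H C) ∨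
        (FiniteClass (Forced c C L) ∧ (∀ x, x ∈ H ↔ x ∈ L ∧ ¬ Forced c C L x) ∧
          HomogeneousWith (!c) H C)) := by
  by_cases hF : FiniteClass (Forced c C L)
  · obtain ⟨H, hinf, hH⟩ := exists_infinite_not_forced hF hL
    exact ⟨H, hinf, fun x hx => ((hH x).1 hx).1,
      .inr ⟨hF, hH, homogeneousWith_of_not_forced hR hform hC fun x => (hH x).1⟩⟩
  · obtain ⟨H, hinf, hH⟩ := exists_infinite_forced hF
    exact ⟨H, hinf, fun x hx => (hH x hx).1, .inl ⟨hF, hH, homogeneousWith_of_forced hC hH⟩⟩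

end Construction

theorem proves_LRSATForced (c : Bool) (σ : Fm) :
    Proves RCA0 (allHorn c σ ➔ LRSATForced c (forcedByF c).ex σ) := by
  refine proves_of_models fun N hmodels e f => ?_
  have hN : N.IsRCA := ⟨hmodels⟩
  simp only [LRSATForced, Fm.holds_imp, holds_allHorn, Fm.holds_allS, holds_isInstance]
  rintro hR V C L ⟨-, hform, hC, hL, -⟩
  refine (Fm.holds_and _ _ _ _).2 ⟨?_, ?_⟩
  · simp [holds_forcedByF, forced_iff]
  · simpa using exists_homogeneous hR hform hC hL

theorem proves_LRSAT (c : Bool) (σ : Fm) : Proves RCA0 (allHorn c σ ➔ LRSAT σ) := by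
  refine proves_of_models fun N hmodels e f => ?_
  have hN : N.IsRCA := ⟨hmodels⟩
  simp only [LRSAT, Fm.holds_imp, holds_allHorn, Fm.holds_allS, holds_isInstance]
  rintro hR V C L ⟨-, hform, hC, hL, -⟩
  obtain ⟨H, hinf, hsub, hcases⟩ := exists_homogeneous hR hform hC hL
  have hhom : HomogeneousWith false H C ∨ HomogeneousWith true H C := by
    cases c
    · exact hcases.imp (·.2.2) (·.2.2)
    · exact hcases.symm.imp (·.2.2) (·.2.2)
  simpa [homogeneous] using ⟨H, hinf, hsub, hhom⟩

end SOA

theorem theorem3p9 :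
    (∀ σ : Fm, Proves RCA0 (allHorn true σ ➔ LRSAT σ)) ∧
    (∀ σ : Fm, Proves RCA0 (allHorn false σ ➔ LRSAT σ)) ∧
    (∃ θ : Fm, IsSigma01 θ ∧ ∀ σ : Fm, Proves RCA0 (allHorn true σ ➔ LRSATForced true θ σ)) ∧
    (∃ θ : Fm, IsSigma01 θ ∧ ∀ σ : Fm, Proves RCA0 (allHorn false σ ➔ LRSATForced false θ σ)) :=
  ⟨proves_LRSAT true, proves_LRSAT false,
    ⟨(forcedByF true).ex, ⟨_, isBounded_forcedByF true, rfl⟩, proves_LRSATForced true⟩,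
    ⟨(forcedByF false).ex, ⟨_, isBounded_forcedByF false, rfl⟩, proves_LRSATForced false⟩⟩
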